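/- Let $A\in\mathbb{R}^{d\times d}$ be invertible and let $s=(s_1,\dots,s_d)^{\mathsf T}$ be a random vector with mutually independent, square integrable components of unit variance. Put $x=As$, let $\tilde x=\mathrm{Cov}(x)^{-1/2}(x-\mathbb{E}[x])$ be the centered and whitened observation, and let $a_1,\dots,a_d$ (the demixing vectors) be the columns of the orthogonal matrix $(AA^{\mathsf T})^{-1/2}A$ (so $a_i$ is the $i$-th column of $A$ if $A$ is orthogonal). Let $\mathcal S$ be the Euclidean unit sphere of $\mathbb{R}^d$. Let $G:\mathbb{R}\to\mathbb{R}$ be three times continuously differentiable and even, $g=G'$, and assume that $$h(w)=\mathbb{E}\big[g'(w^{\mathsf T}\tilde x)\,w-g(w^{\mathsf T}\tilde x)\,\tilde x\big]\neq 0\qquad\text{for all } w\in\mathcal S .$$ Assume also that the expectations of $g(w^{\mathsf T}\tilde x)\tilde x$, $g'(w^{\mathsf T}\tilde x)\tilde x\tilde x^{\mathsf T}$, $g''(w^{\mathsf T}\tilde x)\tilde x$ are well defined in the following locally uniform sense: there are $\delta>0$ and an integrable random variable $B$ such that, almost surely, $|g(w^{\mathsf T}\tilde x+c)|(1+\|\tilde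 x\|)\le B$, $|g'(w^{\mathsf T}\tilde x+c)|(1+\|\tilde x\|)^2\le B$ and $|g''(w^{\mathsf T}\tilde x+c)|(1+\|\tilde x\|)\le B$ for all $w\in\mathbb{R}^d$, $c\in\mathbb{R}$ with $|\|w\|-1|\le\delta$, $|c|\le\delta$. Let $s(1),s(2),\dots$ be independent copies of $s$ and let $x(t)=As(t)$ (noiseless data). For $N\ge1$ let $\bar x=\frac1N\sum_{t\le N}x(t)$, $C_N=\frac1N\sum_{t\le N}(x(t)-\bar x)(x(t)-\bar x)^{\mathsf T}$, $\tilde x(t)=C_N^{-1/2}(x(t)-\bar x)$, and $$\hat h(w)=\frac1N\sum_{t=1}^N\Big(g'(w^{\mathsf T}\tilde x(t))\,w-g(w^{\mathsf T}\tilde x(t))\,\tilde x(t)\Big),\qquad \hat f(w)=\frac{\hat h(w)}{\|\hat h(w)\|},\qquad \hat J(w)=\frac1N\sum_{t=1}^N G(w^{\mathsf T}\tilde x(t)).$$ Let $\hat F$ be the set of all $v\in\mathbb{R}^d$ with $\hat h(v)\ne0$ and $\hat f(v)=\pm v$, let $\hat L$ be the set of $v\in\hat F$ with $\|\hat f'(v)\|<1$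 (spectral norm of the derivative), and let $\hat O$ be the set of $v\in\mathcal S$ that are local minimizers or local maximizers of $\hat J$ on $\mathcal S$. Then there are $r>0$ (not random and independent of $N$) and vectors $\hat a_1,\dots,\hat a_d\in\mathbb{R}^d$ depending on $N$ and on the outcome such that with probability one $\hat a_i\to a_i$ as $N\to\infty$ for each $i$, and for all large enough $N$: for each $i$ and every starting point $w^{(0)}\in\mathcal S$ with $\|w^{(0)}-a_i\|<r$, the iterates $w^{(n+1)}=\hat f(w^{(n)})$ converge to $\hat a_i$ up to sign, i.e. $\min\{\|w^{(n)}-\hat a_i\|,\|w^{(n)}+\hat a_i\|\}\to0$ as $n\to\infty$; and, with $\hat D=\{\pm\hat a_i:\ i=1,\dots,d\}$, $$\hat D\subset\hat L\subset\hat O\subset\hat F .$$ -/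

import Mathlib

open MeasureTheory ProbabilityTheory Filter Topology
open scoped Matrix

noncomputable section

namespace FastICA

/-- Signals, weight vectors: `ℝ^d` with the Euclidean norm. -/
abbrev Vec (d : ℕ) : Type := EuclideanSpace ℝ (Fin d)

/-- The unit sphere `𝒮` of `ℝ^d`. -/
def unitSphere (d : ℕ) : Set (Vec d) := Metric.sphere 0 1

/-- A matrix applied to a Euclidean vector. -/
def act {d : ℕ} (M : Matrix (Fin d) (Fin d) ℝ) (v : Vec d) : Vec d :=
  WithLp.toLp 2 (M *ᵥ WithLp.ofLp v)

/-- `M^{-1/2}` of a symmetric matrix, through the functional calculus (the symmetric positive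
definite inverse square root when `M` is positive definite). -/
def invSqrt {d : ℕ} (M : Matrix (Fin d) (Fin d) ℝ) : Matrix (Fin d) (Fin d) ℝ :=
  cfc (fun x : ℝ => (Real.sqrt x)⁻¹) M

/-! ### Model -/

/-- Assumptions on the source signal: square integrable, mutually independent
components, each of unit variance (so that its covariance matrix is the identity). -/
structure IsSource {Ω : Type*} [MeasurableSpace Ω] {d : ℕ} (s : Ω → Vec d) (μ : Measure Ω) :
    Prop where
  memLp : ∀ i, MemLp (fun ω => s ω i) 2 μ
  indep : iIndepFun (fun i ω => s ω i) μ
  unit_variance : ∀ i, Var[fun ω => s ω i; μ] = 1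

/-- The observed signal `x = A s` (no noise). -/
def observe {Ω : Type*} {d : ℕ} (A : Matrix (Fin d) (Fin d) ℝ) (s : Ω → Vec d) : Ω → Vec d :=
  fun ω => act A (s ω)

/-- The covariance matrix of a random vector. -/
def covMat {Ω : Type*} [MeasurableSpace Ω] {d : ℕ} (x : Ω → Vec d) (μ : Measure Ω) :
    Matrix (Fin d) (Fin d) ℝ :=
  Matrix.of fun i j => cov[fun ω => x ω i, fun ω => x ω j; μ]

/-- Centering and whitening of a random vector: `Cov(x)^{-1/2} (x - E[x])`. -/
def whiten {Ω : Type*} [MeasurableSpace Ω] {d : ℕ} (x : Ω → Vec d) (μ : Measure Ω) :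
    Ω → Vec d :=
  fun ω => act (invSqrt (covMat x μ)) (x ω - ∫ ω', x ω' ∂μ)

/-- The demixing vector `a_i`: the `i`-th column of the orthogonal mixing matrix
`(A Aᵀ)^{-1/2} A` of the whitened model (equal to `A` when `A` is orthogonal). -/
def demix {d : ℕ} (A : Matrix (Fin d) (Fin d) ℝ) (i : Fin d) : Vec d :=
  WithLp.toLp 2 (fun k => (invSqrt (A * Aᵀ) * A) k i)

/-- `h(w) = E[g'(wᵀz) w - g(wᵀz) z]`, where `g = G'`. -/
def hPop {Ω : Type*} [MeasurableSpace Ω] {d : ℕ} (G : ℝ → ℝ) (z : Ω → Vec d) (μ : Measure Ω)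
    (w : Vec d) : Vec d :=
  ∫ ω, (deriv (deriv G) (inner ℝ w (z ω)) • w - deriv G (inner ℝ w (z ω)) • z ω) ∂μ

/-- The quantities `g(wᵀz) z`, `g'(wᵀz) z zᵀ`, `g''(wᵀz) z` occurring in `h` and `h'`, and their
lower order analogues, are dominated by an integrable random variable, uniformly when `w` is near
the unit sphere and the argument of `g`, `g'`, `g''` is shifted by a small constant. -/
def Dominated {Ω : Type*} [MeasurableSpace Ω] {d : ℕ} (G : ℝ → ℝ) (z : Ω → Vec d)
    (μ : Measure Ω) : Prop :=
  ∃ δ : ℝ, 0 < δ ∧ ∃ B : Ω → ℝ, Integrable B μ ∧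
    ∀ᵐ ω ∂μ, ∀ (w : Vec d) (c : ℝ), |‖w‖ - 1| ≤ δ → |c| ≤ δ →
      |deriv G (inner ℝ w (z ω) + c)| * (1 + ‖z ω‖) ≤ B ω ∧
      |deriv (deriv G) (inner ℝ w (z ω) + c)| * (1 + ‖z ω‖) ^ 2 ≤ B ω ∧
      |deriv (deriv (deriv G)) (inner ℝ w (z ω) + c)| * (1 + ‖z ω‖) ≤ B ω

/-! ### Empirical quantities: `x 0, …, x (N - 1)` are the `N` data vectors -/

/-- The sample mean. -/
def sampleMean {d : ℕ} (N : ℕ) (x : ℕ → Vec d) : Vec d :=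
  (N : ℝ)⁻¹ • ∑ t ∈ Finset.range N, x t

/-- The empirical covariance matrix `C_N`. -/
def sampleCov {d : ℕ} (N : ℕ) (x : ℕ → Vec d) : Matrix (Fin d) (Fin d) ℝ :=
  (N : ℝ)⁻¹ • ∑ t ∈ Finset.range N,
    Matrix.vecMulVec (WithLp.ofLp (x t - sampleMean N x)) (WithLp.ofLp (x t - sampleMean N x))

/-- The empirically centered and whitened data `C_N^{-1/2} (x(t) - x̄)`. -/
def sampleWhiten {d : ℕ} (N : ℕ) (x : ℕ → Vec d) (t : ℕ) : Vec d :=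
  act (invSqrt (sampleCov N x)) (x t - sampleMean N x)

/-- The empirical `h`, formed with the whitened data. -/
def hEmp {d : ℕ} (G : ℝ → ℝ) (N : ℕ) (x : ℕ → Vec d) (w : Vec d) : Vec d :=
  (N : ℝ)⁻¹ • ∑ t ∈ Finset.range N,
    (deriv (deriv G) (inner ℝ w (sampleWhiten N x t)) • w
      - deriv G (inner ℝ w (sampleWhiten N x t)) • sampleWhiten N x t)

/-- The empirical FastICA function `h / ‖h‖`. -/
def fEmp {d : ℕ} (G : ℝ → ℝ) (N : ℕ) (x : ℕ → Vec d) (w : Vec d) : Vec d :=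
  ‖hEmp G N x w‖⁻¹ • hEmp G N x w

/-- The empirical contrast function. -/
def contrastEmp {d : ℕ} (G : ℝ → ℝ) (N : ℕ) (x : ℕ → Vec d) (w : Vec d) : ℝ :=
  (N : ℝ)⁻¹ * ∑ t ∈ Finset.range N, G (inner ℝ w (sampleWhiten N x t))

/-- Convergence in the wide sense, i.e. up to sign. -/
def WideTendsto {d : ℕ} (w : ℕ → Vec d) (v : Vec d) : Prop :=
  Tendsto (fun n => min ‖w n - v‖ ‖w n + v‖) atTop (𝓝 0)

/-! ### The empirical sets -/

/-- The set `{± a_i}`. -/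
def setD {d : ℕ} (a : Fin d → Vec d) : Set (Vec d) :=
  {v | ∃ i, v = a i ∨ v = -a i}

/-- The fixed points, up to sign, of the empirical FastICA function (at which that function
has to be defined, i.e. `h` must not vanish). -/
def setF {d : ℕ} (G : ℝ → ℝ) (N : ℕ) (x : ℕ → Vec d) : Set (Vec d) :=
  {v | hEmp G N x v ≠ 0 ∧ (fEmp G N x v = v ∨ fEmp G N x v = -v)}

/-- The attractive fixed points; the norm is the spectral norm. -/
def setL {d : ℕ} (G : ℝ → ℝ) (N : ℕ) (x : ℕ → Vec d) : Set (Vec d) :=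
  {v | v ∈ setF G N x ∧ DifferentiableAt ℝ (fEmp G N x) v ∧ ‖fderiv ℝ (fEmp G N x) v‖ < 1}

/-- The local minimizers and local maximizers of the empirical contrast on the sphere. -/
def setO {d : ℕ} (G : ℝ → ℝ) (N : ℕ) (x : ℕ → Vec d) : Set (Vec d) :=
  {v | v ∈ unitSphere d ∧ IsLocalExtrOn (contrastEmp G N x) (unitSphere d) v}

end FastICA

end

/-! ### Normalization to the unit sphere. -/

section Normalize

variable {E : Type*} [NormedAddCommGroup E] [InnerProductSpace ℝ E]

/-! In the basis of demixing vectors the whitened observation has the centered sources as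
coordinates. By independence, zero mean and unit variance, the population field at `a_i` is a
multiple of `a_i` and its derivative there has range in the line of `a_i`
(`integral_icaTerm_eq_smul`, `integral_icaTermDeriv_apply_eq_smul`). Normalization has zero
derivative in the radial direction, so the population FastICA map has zero derivative at `a_i`.

A strong law in a space of continuous functions carries this to the data: direction, whitening
matrix and center are treated as parameters, and the last two converge almost surely. Hence on a
fixed ball around `a_i` the derivative of the empirical map eventually has norm at most 1/2, and the
map or its negative is a contraction moving `a_i` only slightly (`exists_attractive_fixedPoint`).
Its fixed point is `â_i`; oddness of the map absorbs the signs.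

For the remaining inclusions, the gradient of the empirical contrast is a radial vector minus the
empirical field. An attractive fixed point makes the contrast monotone along every short great
circle leaving it (`isLocalExtrOn_sphere_of_norm_fderiv_lt_one`). At a local extremum the tangential
part of the field vanishes (`eq_smul_of_isLocalExtrOn_sphere`), and compactness of the sphere keeps
the field nonzero (`ae_eventually_hEmp_ne_zero`). -/

theorem contDiffAt_norm_inv_smul {x : E} (hx : x ≠ 0) :
    ContDiffAt ℝ 1 (fun y : E => ‖y‖⁻¹ • y) x :=
  ((contDiffAt_norm ℝ hx).inv (norm_ne_zero_iff.2 hx)).smul contDiffAt_id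

/-- Normalization is constant along the open ray through `x`. -/
theorem fderiv_norm_inv_smul_apply_smul {x : E} (hx : x ≠ 0) (c : ℝ) :
    fderiv ℝ (fun y : E => ‖y‖⁻¹ • y) x (c • x) = 0 := by
  have h1 : HasFDerivAt (fun y : E => ‖y‖⁻¹ • y) (fderiv ℝ (fun y : E => ‖y‖⁻¹ • y) x) x :=
    ((contDiffAt_norm_inv_smul hx).differentiableAt (by norm_num)).hasFDerivAt
  have h2 : HasDerivAt (fun t : ℝ => (1 + t) • x) x 0 := by
    simpa using ((hasDerivAt_id (0 : ℝ)).const_add 1).smul_const x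
  have h3 : HasDerivAt (fun t : ℝ => ‖(1 + t) • x‖⁻¹ • ((1 + t) • x))
      (fderiv ℝ (fun y : E => ‖y‖⁻¹ • y) x x) 0 := by
    have h1' : HasFDerivAt (fun y : E => ‖y‖⁻¹ • y)
        (fderiv ℝ (fun y : E => ‖y‖⁻¹ • y) x) ((1 + (0 : ℝ)) • x) := by simpa using h1
    exact h1'.comp_hasDerivAt (0 : ℝ) h2
  have h4 : HasDerivAt (fun t : ℝ => ‖(1 + t) • x‖⁻¹ • ((1 + t) • x)) 0 0 := by
    refine (hasDerivAt_const (0 : ℝ) (‖x‖⁻¹ • x)).congr_of_eventuallyEq ?_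
    filter_upwards [Ioi_mem_nhds (show (-1 : ℝ) < 0 by norm_num)] with t ht
    have ht' : 0 < 1 + t := by have := Set.mem_Ioi.1 ht; linarith
    rw [norm_smul, Real.norm_of_nonneg ht'.le, smul_smul, mul_inv, mul_right_comm,
      inv_mul_cancel₀ ht'.ne', one_mul]
  rw [map_smul, h3.unique h4, smul_zero]

theorem norm_inv_smul_eq_of_eq_smul {x v : E} (hx : x ≠ 0) (hv : ‖v‖ = 1) {c : ℝ}
    (h : x = c • v) : ‖x‖⁻¹ • x = v ∨ ‖x‖⁻¹ • x = -v := by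
  have hc : c ≠ 0 := by rintro rfl; simp at h; exact hx h
  rw [h, norm_smul, hv, mul_one, smul_smul, Real.norm_eq_abs]
  rcases abs_cases c with ⟨h1, -⟩ | ⟨h1, -⟩
  · left; rw [h1, inv_mul_cancel₀ hc, one_smul]
  · right; rw [h1, inv_neg, neg_mul, inv_mul_cancel₀ hc, neg_smul, one_smul]

end Normalize

/-! ### Half-contractions of a ball, and iteration up to sign. -/

section Contraction

variable {E : Type*} [NormedAddCommGroup E] {φ : E → E} {a v : E} {ρ : ℝ}

/-- The contraction uses half of the radius; the other half allows the center to move. -/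
theorem mapsTo_closedBall_of_half_lipschitz
    (hφ : ∀ x ∈ Metric.closedBall a ρ, ∀ y ∈ Metric.closedBall a ρ, ‖φ x - φ y‖ ≤ 1 / 2 * ‖x - y‖)
    (hρ : 0 ≤ ρ) (ha : ‖φ a - a‖ ≤ ρ / 2) :
    Set.MapsTo φ (Metric.closedBall a ρ) (Metric.closedBall a ρ) := by
  intro x hx
  have h1 := hφ x hx a (Metric.mem_closedBall_self hρ)
  rw [mem_closedBall_iff_norm] at hx ⊢
  have h2 : ‖φ x - a‖ ≤ ‖φ x - φ a‖ + ‖φ a - a‖ := norm_sub_le_norm_sub_add_norm_sub _ _ _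
  linarith

theorem exists_fixedPoint_of_half_lipschitz [CompleteSpace E]
    (hφ : ∀ x ∈ Metric.closedBall a ρ, ∀ y ∈ Metric.closedBall a ρ, ‖φ x - φ y‖ ≤ 1 / 2 * ‖x - y‖)
    (hρ : 0 ≤ ρ) (ha : ‖φ a - a‖ ≤ ρ / 2) : ∃ v ∈ Metric.closedBall a ρ, φ v = v := by
  have hm := mapsTo_closedBall_of_half_lipschitz hφ hρ ha
  have hc : ContractingWith (1 / 2) (hm.restrict φ _ _) := by
    refine ⟨by rw [← NNReal.coe_lt_coe]; norm_num, LipschitzWith.of_dist_le_mul fun x y => ?_⟩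
    rw [Subtype.dist_eq, Subtype.dist_eq, dist_eq_norm, dist_eq_norm]
    simpa using hφ x x.2 y y.2
  obtain ⟨v, hv, hfix, -⟩ := hc.exists_fixedPoint' Metric.isClosed_closedBall.isComplete hm
    (Metric.mem_closedBall_self hρ) (edist_ne_top _ _)
  exact ⟨v, hv, hfix⟩

theorem norm_iterate_sub_le_of_half_lipschitz
    (hφ : ∀ x ∈ Metric.closedBall a ρ, ∀ y ∈ Metric.closedBall a ρ, ‖φ x - φ y‖ ≤ 1 / 2 * ‖x - y‖)
    (hm : Set.MapsTo φ (Metric.closedBall a ρ) (Metric.closedBall a ρ))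
    (hv : v ∈ Metric.closedBall a ρ) (hfix : φ v = v) {w : E} (hw : w ∈ Metric.closedBall a ρ)
    (n : ℕ) : ‖φ^[n] w - v‖ ≤ (1 / 2) ^ n * ‖w - v‖ := by
  induction n with
  | zero => simp
  | succ n ih =>
    rw [Function.iterate_succ_apply']
    have h := hφ _ (hm.iterate n hw) v hv
    rw [hfix] at h
    rw [pow_succ]
    linarith

/-- The FastICA map may send a neighbourhood of `a` near `-a`; then its negative is the map with a
fixed point there, and the two orbits agree up to sign. -/
theorem iterate_eq_or_eq_neg {f : E → E} (hodd : ∀ x, f (-x) = -f x)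
    (hφ : (∀ x, φ x = f x) ∨ ∀ x, φ x = -f x) (w : E) (n : ℕ) :
    f^[n] w = φ^[n] w ∨ f^[n] w = -φ^[n] w := by
  induction n with
  | zero => simp
  | succ n ih =>
    rw [Function.iterate_succ_apply', Function.iterate_succ_apply']
    rcases hφ with hφ | hφ <;> rcases ih with ih | ih <;> simp [ih, hφ, hodd]

theorem tendsto_min_norm_iterate {f : E → E} (hodd : ∀ x, f (-x) = -f x)
    (hσ : (∀ x, φ x = f x) ∨ ∀ x, φ x = -f x)
    (hφ : ∀ x ∈ Metric.closedBall a ρ, ∀ y ∈ Metric.closedBall a ρ, ‖φ x - φ y‖ ≤ 1 / 2 * ‖x - y‖)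
    (hm : Set.MapsTo φ (Metric.closedBall a ρ) (Metric.closedBall a ρ))
    (hv : v ∈ Metric.closedBall a ρ) (hfix : φ v = v) {w : E} (hw : w ∈ Metric.closedBall a ρ) :
    Tendsto (fun n => min ‖f^[n] w - v‖ ‖f^[n] w + v‖) atTop (𝓝 0) := by
  have hlim : Tendsto (fun n : ℕ => (1 / 2 : ℝ) ^ n * ‖w - v‖) atTop (𝓝 0) := by
    simpa using (tendsto_pow_atTop_nhds_zero_of_lt_one (r := (1 / 2 : ℝ)) (by norm_num)
      (by norm_num)).mul_const ‖w - v‖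
  refine squeeze_zero (fun n => by positivity) (fun n => ?_) hlim
  refine le_trans ?_ (norm_iterate_sub_le_of_half_lipschitz hφ hm hv hfix hw n)
  rcases iterate_eq_or_eq_neg hodd hσ w n with h | h
  · rw [h]; exact min_le_left _ _
  · refine (min_le_right _ _).trans (le_of_eq ?_)
    rw [h, ← norm_neg]; congr 1; abel

end Contraction

/-! ### Great circles, and extrema on the sphere against fixed points of the field. -/

section Geodesic

variable {E : Type*} [NormedAddCommGroup E] [InnerProductSpace ℝ E]

/-- The point at angle `τ` on the great circle through `v` in the direction `u`. -/
noncomputable def greatCircle (v u : E) (τ : ℝ) : E := Real.cos τ • v + Real.sin τ • u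

theorem hasDerivAt_greatCircle (v u : E) (τ : ℝ) :
    HasDerivAt (greatCircle v u) (-Real.sin τ • v + Real.cos τ • u) τ :=
  ((Real.hasDerivAt_cos τ).smul_const v).add ((Real.hasDerivAt_sin τ).smul_const u)

@[simp] theorem greatCircle_zero (v u : E) : greatCircle v u 0 = v := by simp [greatCircle]

variable {v u : E}

theorem norm_sq_cos_smul_add (hv : ‖v‖ = 1) (hu : ‖u‖ = 1) (huv : inner ℝ v u = 0) (a b : ℝ) :
    ‖a • v + b • u‖ ^ 2 = a ^ 2 + b ^ 2 := by
  rw [norm_add_sq_real, norm_smul, norm_smul, inner_smul_left, inner_smul_right, huv, hv, hu]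
  simp

theorem norm_greatCircle (hv : ‖v‖ = 1) (hu : ‖u‖ = 1) (huv : inner ℝ v u = 0) (τ : ℝ) :
    ‖greatCircle v u τ‖ = 1 := by
  have := norm_sq_cos_smul_add hv hu huv (Real.cos τ) (Real.sin τ)
  rw [Real.cos_sq_add_sin_sq] at this
  exact (pow_eq_one_iff_of_nonneg (norm_nonneg _) two_ne_zero).1 this

theorem norm_greatCircle_sub_le (hv : ‖v‖ = 1) (hu : ‖u‖ = 1) (huv : inner ℝ v u = 0) {τ : ℝ}
    (hτ : 0 ≤ τ) : ‖greatCircle v u τ - v‖ ≤ τ := by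
  have h : greatCircle v u τ - v = (Real.cos τ - 1) • v + Real.sin τ • u := by
    rw [greatCircle, sub_smul, one_smul]; abel
  rw [h]
  refine (sq_le_sq₀ (norm_nonneg _) hτ).1 ?_
  rw [norm_sq_cos_smul_add hv hu huv]
  -- The squared chord is `2 - 2 cos τ`, at most `τ ^ 2`.
  nlinarith [Real.one_sub_sq_div_two_le_cos (x := τ), Real.cos_sq_add_sin_sq τ]

theorem inner_greatCircle_deriv (hv : ‖v‖ = 1) (hu : ‖u‖ = 1) (huv : inner ℝ v u = 0) (τ : ℝ) :
    inner ℝ (greatCircle v u τ) (-Real.sin τ • v + Real.cos τ • u) = 0 := by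
  have huv' : inner ℝ u v = 0 := by rw [real_inner_comm]; exact huv
  simp only [greatCircle, inner_add_left, inner_add_right, inner_smul_left, inner_smul_right,
    huv, huv', real_inner_self_eq_norm_sq, hv, hu]
  simp; ring

/-- A point of the unit sphere other than `±v` lies on a great circle through `v`, at its angle
with `v`. -/
theorem exists_greatCircle (hv : ‖v‖ = 1) {w : E} (hw : ‖w‖ = 1) (hne : w ≠ v)
    (hne' : w ≠ -v) :
    ∃ u : E, ‖u‖ = 1 ∧ inner ℝ v u = 0 ∧ greatCircle v u (InnerProductGeometry.angle v w) = w := by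
  set θ := InnerProductGeometry.angle v w with hθ
  have hc : inner ℝ v w = Real.cos θ := by
    rw [hθ, InnerProductGeometry.cos_angle, hv, hw]; simp
  have hs : 0 ≤ Real.sin θ := InnerProductGeometry.sin_angle_nonneg _ _
  have hs2 : Real.sin θ ≠ 0 := by
    intro h0
    have h1 : Real.cos θ ^ 2 = 1 := by nlinarith [Real.cos_sq_add_sin_sq θ]
    rcases (by simpa using h1 : Real.cos θ = 1 ∨ Real.cos θ = -1) with h | h
    · exact hne ((inner_eq_one_iff_of_norm_eq_one (𝕜 := ℝ) hv hw).1 (hc.trans h)).symm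
    · exact hne' (by
        have hvw : inner ℝ v (-w) = 1 := by rw [inner_neg_right, hc, h, neg_neg]
        rw [(inner_eq_one_iff_of_norm_eq_one (𝕜 := ℝ) hv (by rwa [norm_neg])).1 hvw, neg_neg])
  have hnorm : ‖w - Real.cos θ • v‖ = Real.sin θ := by
    have : ‖w - Real.cos θ • v‖ ^ 2 = Real.sin θ ^ 2 := by
      rw [norm_sub_sq_real, norm_smul, inner_smul_right, real_inner_comm, hc, hv, hw]
      simp
      nlinarith [Real.cos_sq_add_sin_sq θ]
    exact (sq_eq_sq₀ (norm_nonneg _) hs).1 this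
  refine ⟨(Real.sin θ)⁻¹ • (w - Real.cos θ • v), ?_, ?_, ?_⟩
  · rw [norm_smul, hnorm, norm_inv, Real.norm_of_nonneg hs, inv_mul_cancel₀ hs2]
  · rw [inner_smul_right, inner_sub_right, inner_smul_right, real_inner_self_eq_norm_sq, hv, hc]
    simp
  · rw [greatCircle, smul_smul, mul_inv_cancel₀ hs2, one_smul]; abel

/-- The derivative is controlled at `v` alone, so only distances to `v` contract; `q` is the
midpoint between the norm of the derivative and 1. -/
theorem norm_sub_le_mul_of_norm_fderiv_lt_one {f : E → E} {v : E} (hf : DifferentiableAt ℝ f v)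
    (hlt : ‖fderiv ℝ f v‖ < 1) :
    ∃ q < 1, 0 ≤ q ∧ ∀ᶠ w in 𝓝 v, ‖f w - f v‖ ≤ q * ‖w - v‖ := by
  refine ⟨(1 + ‖fderiv ℝ f v‖) / 2, by linarith, by positivity, ?_⟩
  have h := hf.hasFDerivAt.isLittleO.def (c := (1 - ‖fderiv ℝ f v‖) / 2) (by linarith)
  filter_upwards [h] with w hw
  have h1 : ‖f w - f v‖ ≤ ‖f w - f v - fderiv ℝ f v (w - v)‖ + ‖fderiv ℝ f v (w - v)‖ := by
    simpa using norm_add_le (f w - f v - fderiv ℝ f v (w - v)) (fderiv ℝ f v (w - v))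
  have h2 := (fderiv ℝ f v).le_opNorm (w - v)
  linarith

theorem exists_mul_le_sin {q : ℝ} (hq : q < 1) :
    ∃ θ₀ > 0, ∀ τ, 0 ≤ τ → τ ≤ θ₀ → q * τ ≤ Real.sin τ := by
  refine ⟨min 1 (1 - q), lt_min one_pos (by linarith), fun τ h0 h1 => ?_⟩
  rcases h0.eq_or_lt with rfl | h0
  · simp
  have h2 := Real.sin_gt_sub_cube h0
  have h3 : τ ≤ 1 - q := h1.trans (min_le_right _ _)
  have h4 : τ ≤ 1 := h1.trans (min_le_left _ _)
  nlinarith [mul_nonneg h0.le (by linarith : 0 ≤ 1 - q - τ),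
    mul_nonneg (mul_nonneg h0.le h0.le) (sub_nonneg.2 h4)]

variable {J k : E → ℝ} {h : E → E}

/-- The radial part `k w • w` of the gradient drops out because the velocity is tangent to the
sphere. -/
theorem hasDerivAt_comp_greatCircle (hJ : ∀ w, HasFDerivAt J (innerSL ℝ (k w • w - h w)) w)
    (hv : ‖v‖ = 1) (hu : ‖u‖ = 1) (huv : inner ℝ v u = 0) (τ : ℝ) :
    HasDerivAt (fun τ => J (greatCircle v u τ))
      (-inner ℝ (h (greatCircle v u τ)) (-Real.sin τ • v + Real.cos τ • u)) τ := by
  have := (hJ (greatCircle v u τ)).comp_hasDerivAt τ (hasDerivAt_greatCircle v u τ)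
  convert! this using 1
  rw [innerSL_apply_apply, inner_sub_left, inner_smul_left, inner_greatCircle_deriv hv hu huv]
  simp

/-- If the tangential part of the gradient of `J` on the unit sphere is that of `-h`, then an
attractive fixed point, up to sign, of `h / ‖h‖` is a local extremum of `J` on the sphere. -/
theorem isLocalExtrOn_sphere_of_norm_fderiv_lt_one
    (hJ : ∀ w, HasFDerivAt J (innerSL ℝ (k w • w - h w)) w) (hv : ‖v‖ = 1) {σ : ℝ}
    (hσ : σ = 1 ∨ σ = -1) (hfix : ‖h v‖⁻¹ • h v = σ • v)
    (hf : DifferentiableAt ℝ (fun w => ‖h w‖⁻¹ • h w) v)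
    (hlt : ‖fderiv ℝ (fun w => ‖h w‖⁻¹ • h w) v‖ < 1) :
    IsLocalExtrOn J (Metric.sphere 0 1) v := by
  obtain ⟨q, hq1, hq0, hq⟩ := norm_sub_le_mul_of_norm_fderiv_lt_one hf hlt
  obtain ⟨ρ, hρ, hball⟩ := Metric.eventually_nhds_iff.1 hq
  obtain ⟨θ₀, hθ₀, hsin⟩ := exists_mul_le_sin hq1
  have hv0 : v ≠ 0 := by rintro rfl; simp at hv
  have hσσ : σ * σ = 1 := by rcases hσ with rfl | rfl <;> norm_num
  have hangle : ∀ᶠ w in 𝓝 v, InnerProductGeometry.angle v w < min ρ θ₀ := by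
    have hc : ContinuousAt (fun w => InnerProductGeometry.angle v w) v :=
      (InnerProductGeometry.continuousAt_angle (x := (v, v)) hv0 hv0).comp
        (f := fun w => (v, w)) (by fun_prop)
    refine hc.eventually_lt continuousAt_const ?_
    rw [InnerProductGeometry.angle_self hv0]
    exact lt_min hρ hθ₀
  have hneg : ∀ᶠ w in 𝓝 v, w ≠ -v := by
    refine isOpen_ne.mem_nhds ?_
    intro h0
    have := congrArg (inner ℝ v) h0
    rw [inner_neg_right, real_inner_self_eq_norm_sq, hv] at this
    norm_num at this
  -- The factor `σ` treats both signs at once: `σ = 1` gives a minimum, `σ = -1` a maximum.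
  have key : ∀ᶠ w in 𝓝[Metric.sphere 0 1] v, σ * J v ≤ σ * J w := by
    filter_upwards [self_mem_nhdsWithin, mem_nhdsWithin_of_mem_nhds hangle,
      mem_nhdsWithin_of_mem_nhds hneg] with w hw hθ hne'
    rw [mem_sphere_zero_iff_norm] at hw
    by_cases hne : w = v
    · rw [hne]
    obtain ⟨u, hu, huv, hγ⟩ := exists_greatCircle hv hw hne hne'
    set θ := InnerProductGeometry.angle v w
    have hθ0 : 0 ≤ θ := InnerProductGeometry.angle_nonneg _ _
    have hd : ∀ τ, HasDerivAt (fun τ => σ * J (greatCircle v u τ))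
        (σ * -inner ℝ (h (greatCircle v u τ)) (-Real.sin τ • v + Real.cos τ • u)) τ :=
      fun τ => (hasDerivAt_comp_greatCircle hJ hv hu huv τ).const_mul σ
    have hmono : MonotoneOn (fun τ => σ * J (greatCircle v u τ)) (Set.Icc 0 θ) := by
      refine monotoneOn_of_deriv_nonneg (convex_Icc _ _)
        (fun τ _ => (hd τ).continuousAt.continuousWithinAt)
        (fun τ _ => (hd τ).differentiableAt.differentiableWithinAt) fun τ hτ => ?_
      rw [interior_Icc] at hτ
      rw [(hd τ).deriv]
      set γ := greatCircle v u τ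
      set γ' := -Real.sin τ • v + Real.cos τ • u
      have hγ' : ‖γ'‖ = 1 := by
        have h1 : ‖γ'‖ ^ 2 = 1 := by
          rw [norm_sq_cos_smul_add hv hu huv, neg_sq, Real.sin_sq_add_cos_sq]
        exact (pow_eq_one_iff_of_nonneg (norm_nonneg _) two_ne_zero).1 h1
      have hγv : ‖γ - v‖ ≤ τ := norm_greatCircle_sub_le hv hu huv hτ.1.le
      have hτlt : τ < min ρ θ₀ := hτ.2.trans hθ
      have hlip : ‖‖h γ‖⁻¹ • h γ - σ • v‖ ≤ q * τ := by
        have := hball (y := γ) (by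
          rw [dist_eq_norm]; exact hγv.trans_lt (hτlt.trans_le (min_le_left _ _)))
        rw [hfix] at this
        exact this.trans (mul_le_mul_of_nonneg_left hγv hq0)
      -- The field points along `σ • v` up to an error of norm at most `q * τ`. The identity also
      -- covers `h γ = 0`.
      have hh : h γ = ‖h γ‖ • (σ • v + (‖h γ‖⁻¹ • h γ - σ • v)) := by
        rw [add_sub_cancel, smul_smul]
        by_cases h0 : h γ = 0
        · simp [h0]
        · rw [mul_inv_cancel₀ (norm_ne_zero_iff.2 h0), one_smul]
      have hvγ' : inner ℝ v γ' = -Real.sin τ := by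
        rw [inner_add_right, inner_smul_right, inner_smul_right, huv,
          real_inner_self_eq_norm_sq, hv]
        ring
      have hrem : σ * inner ℝ (‖h γ‖⁻¹ • h γ - σ • v) γ' ≤ q * τ := by
        refine (le_abs_self _).trans ?_
        have h1 : |σ| = 1 := by rcases hσ with rfl | rfl <;> simp
        rw [abs_mul, h1, one_mul]
        refine (abs_real_inner_le_norm _ _).trans ?_
        rwa [hγ', mul_one]
      have hs := hsin τ hτ.1.le (hτlt.le.trans (min_le_right _ _))
      -- The main direction contributes `sin τ`, which dominates the error `q * τ` for small angles.
      have : σ * -inner ℝ (h γ) γ' = ‖h γ‖ * (Real.sin τ -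
          σ * inner ℝ (‖h γ‖⁻¹ • h γ - σ • v) γ') := by
        conv_lhs => rw [hh]
        rw [inner_smul_left, inner_add_left, inner_smul_left, hvγ']
        simp only [conj_trivial]
        linear_combination (‖h γ‖ * Real.sin τ) * hσσ
      rw [this]
      exact mul_nonneg (norm_nonneg _) (by linarith)
    have := hmono (Set.left_mem_Icc.2 hθ0) (Set.right_mem_Icc.2 hθ0) hθ0
    simpa [hγ] using this
  rcases hσ with rfl | rfl
  · left; filter_upwards [key] with w hw; linarith
  · right; filter_upwards [key] with w hw; linarith

/-- If the tangential part `p` of `h v` were nonzero, `J` would have slope `-‖p‖` at `v` along the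
great circle in direction `p`. -/
theorem eq_smul_of_isLocalExtrOn_sphere
    (hJ : ∀ w, HasFDerivAt J (innerSL ℝ (k w • w - h w)) w) (hv : ‖v‖ = 1)
    (hext : IsLocalExtrOn J (Metric.sphere 0 1) v) : h v = inner ℝ v (h v) • v := by
  by_contra hne
  set p := h v - inner ℝ v (h v) • v with hp
  have hp0 : p ≠ 0 := sub_ne_zero.2 hne
  have hpn : ‖p‖ ≠ 0 := norm_ne_zero_iff.2 hp0
  have hvp : inner ℝ v p = 0 := by
    rw [hp, inner_sub_right, inner_smul_right, real_inner_self_eq_norm_sq, hv]; ring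
  have hu : ‖‖p‖⁻¹ • p‖ = 1 := by rw [norm_smul, norm_inv, norm_norm, inv_mul_cancel₀ hpn]
  have huv : inner ℝ v (‖p‖⁻¹ • p) = 0 := by rw [inner_smul_right, hvp, mul_zero]
  have hd := hasDerivAt_comp_greatCircle hJ hv hu huv 0
  have hmap : Tendsto (greatCircle v (‖p‖⁻¹ • p)) (𝓝 0) (𝓝[Metric.sphere 0 1] v) := by
    refine tendsto_nhdsWithin_iff.2 ⟨?_, Eventually.of_forall fun τ => ?_⟩
    · simpa using (hasDerivAt_greatCircle v (‖p‖⁻¹ • p) 0).continuousAt.tendsto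
    · rw [mem_sphere_zero_iff_norm]; exact norm_greatCircle hv hu huv τ
  have hloc : IsLocalExtr (fun τ => J (greatCircle v (‖p‖⁻¹ • p) τ)) 0 := by
    rcases hext with hmin | hmax
    · left
      have := hmap.eventually hmin
      simpa [IsLocalMin, IsMinFilter] using this
    · right
      have := hmap.eventually hmax
      simpa [IsLocalMax, IsMaxFilter] using this
  have h0 := hloc.hasDerivAt_eq_zero hd
  rw [greatCircle_zero] at h0
  have h1 : inner ℝ (h v) p = ‖p‖ ^ 2 := by
    have : h v = p + inner ℝ v (h v) • v := by rw [hp]; abel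
    conv_lhs => rw [this]
    rw [inner_add_left, inner_smul_left, hvp, real_inner_self_eq_norm_sq]; simp
  simp only [Real.sin_zero, Real.cos_zero, neg_zero, zero_smul, one_smul, zero_add,
    inner_smul_right, h1, neg_eq_zero] at h0
  have : ‖p‖⁻¹ * ‖p‖ ^ 2 = ‖p‖ := by field_simp
  exact hpn (this ▸ h0)

end Geodesic

/-! ### The contribution of one data vector to the field. -/

section Field

variable {E : Type*} [NormedAddCommGroup E] [InnerProductSpace ℝ E] {G : ℝ → ℝ}

/-- The contribution `g'(wᵀy) w - g(wᵀy) y` of one data vector `y` to the FastICA field. -/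
noncomputable def icaTerm (G : ℝ → ℝ) (w y : E) : E :=
  deriv (deriv G) (inner ℝ w y) • w - deriv G (inner ℝ w y) • y

/-- The derivative of `icaTerm G w y` with respect to `w`. -/
noncomputable def icaTermDeriv (G : ℝ → ℝ) (w y : E) : E →L[ℝ] E :=
  deriv (deriv (deriv G)) (inner ℝ w y) • (innerSL ℝ y).smulRight w +
    deriv (deriv G) (inner ℝ w y) • (ContinuousLinearMap.id ℝ E - (innerSL ℝ y).smulRight y)

theorem icaTermDeriv_apply (w y u : E) :
    icaTermDeriv G w y u = (deriv (deriv (deriv G)) (inner ℝ w y) * inner ℝ y u) • w +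
      deriv (deriv G) (inner ℝ w y) • (u - inner ℝ y u • y) := by
  simp [icaTermDeriv, smul_smul]

theorem contDiff_two_deriv (hG : ContDiff ℝ 3 G) : ContDiff ℝ 2 (deriv G) :=
  (contDiff_succ_iff_deriv (n := 2)).1
    (by rwa [show (2 + 1 : WithTop ℕ∞) = 3 by norm_num]) |>.2.2

theorem contDiff_one_deriv_deriv (hG : ContDiff ℝ 3 G) : ContDiff ℝ 1 (deriv (deriv G)) :=
  (contDiff_succ_iff_deriv (n := 1)).1
    (by rw [show (1 + 1 : WithTop ℕ∞) = 2 by norm_num]; exact contDiff_two_deriv hG) |>.2.2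

theorem continuous_deriv_three (hG : ContDiff ℝ 3 G) : Continuous (deriv (deriv (deriv G))) :=
  ((contDiff_succ_iff_deriv (n := 0)).1 (by simpa using contDiff_one_deriv_deriv hG)).2.2.continuous

theorem hasFDerivAt_icaTerm (hG : ContDiff ℝ 3 G) (w y : E) :
    HasFDerivAt (fun w => icaTerm G w y) (icaTermDeriv G w y) w := by
  have hi : HasFDerivAt (fun w : E => inner ℝ w y) (innerSL ℝ y) w := by
    convert! (innerSL ℝ y).hasFDerivAt (x := w) using 2 with x
    rw [innerSL_apply_apply, real_inner_comm]
  have h1 := (((contDiff_two_deriv hG).differentiable (by norm_num))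
    (inner ℝ w y)).hasDerivAt.comp_hasFDerivAt w hi
  have h2 := (((contDiff_one_deriv_deriv hG).differentiable (by norm_num))
    (inner ℝ w y)).hasDerivAt.comp_hasFDerivAt w hi
  convert! (h2.smul (hasFDerivAt_id w)).sub (h1.smul_const y) using 1
  ext u
  simp [icaTermDeriv_apply, smul_sub, smul_smul]
  abel

theorem continuous_icaTerm (hG : ContDiff ℝ 3 G) : Continuous fun p : E × E => icaTerm G p.1 p.2 := by
  have h1 := (contDiff_two_deriv hG).continuous
  have h2 := (contDiff_one_deriv_deriv hG).continuous
  unfold icaTerm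
  fun_prop

theorem continuous_icaTermDeriv (hG : ContDiff ℝ 3 G) :
    Continuous fun p : E × E => icaTermDeriv G p.1 p.2 := by
  have h1 := continuous_deriv_three hG
  have h2 := (contDiff_one_deriv_deriv hG).continuous
  have h3 : Continuous fun p : E × E => (innerSL ℝ p.2).smulRight p.1 :=
    (ContinuousLinearMap.smulRightL ℝ E E).continuous₂.comp
      (((innerSL ℝ).continuous.comp continuous_snd).prodMk continuous_fst)
  have h4 : Continuous fun p : E × E => (innerSL ℝ p.2).smulRight p.2 :=
    h3.comp (continuous_snd.prodMk continuous_snd)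
  unfold icaTermDeriv
  fun_prop

theorem norm_icaTerm_le (w y : E) :
    ‖icaTerm G w y‖ ≤ |deriv (deriv G) (inner ℝ w y)| * ‖w‖ + |deriv G (inner ℝ w y)| * ‖y‖ := by
  refine (norm_sub_le _ _).trans ?_
  rw [norm_smul, norm_smul, Real.norm_eq_abs, Real.norm_eq_abs]

theorem norm_icaTermDeriv_le (w y : E) :
    ‖icaTermDeriv G w y‖ ≤ |deriv (deriv (deriv G)) (inner ℝ w y)| * (‖y‖ * ‖w‖) +
      |deriv (deriv G) (inner ℝ w y)| * (1 + ‖y‖ ^ 2) := by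
  refine (norm_add_le _ _).trans (add_le_add ?_ ?_)
  · rw [norm_smul, Real.norm_eq_abs, ContinuousLinearMap.norm_smulRight_apply, innerSL_apply_norm]
  · rw [norm_smul, Real.norm_eq_abs]
    refine mul_le_mul_of_nonneg_left ((norm_sub_le _ _).trans (add_le_add ?_ ?_)) (abs_nonneg _)
    · exact ContinuousLinearMap.norm_id_le
    · rw [ContinuousLinearMap.norm_smulRight_apply, innerSL_apply_norm, sq]

theorem deriv_neg_of_even {f : ℝ → ℝ} (hf : ∀ y, f (-y) = f y) (y : ℝ) :
    deriv f (-y) = -deriv f y := by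
  have h : (fun x => f (-x)) = f := funext hf
  have := deriv_comp_neg f y
  rw [h] at this
  rw [this, neg_neg]

theorem deriv_neg_of_odd {f : ℝ → ℝ} (hf : ∀ y, f (-y) = -f y) (y : ℝ) :
    deriv f (-y) = deriv f y := by
  have h : (fun x => f (-x)) = fun x => -f x := funext hf
  have := deriv_comp_neg f y
  rw [h, deriv.fun_neg] at this
  exact (neg_injective this).symm

theorem icaTerm_neg (hG : ∀ y, G (-y) = G y) (w y : E) : icaTerm G (-w) y = -icaTerm G w y := by
  rw [icaTerm, icaTerm, inner_neg_left, deriv_neg_of_odd (deriv_neg_of_even hG),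
    deriv_neg_of_even hG, smul_neg, neg_smul]
  abel

end Field

/-! ### The empirical field and contrast, and two of the inclusions. -/

namespace FastICA

variable {d : ℕ} {G : ℝ → ℝ} (N : ℕ) (x : ℕ → Vec d)

theorem hEmp_eq_sum_icaTerm (w : Vec d) :
    hEmp G N x w = (N : ℝ)⁻¹ • ∑ t ∈ Finset.range N, icaTerm G w (sampleWhiten N x t) := rfl

/-- The derivative of `hEmp`. -/
noncomputable def hEmpDeriv (G : ℝ → ℝ) (N : ℕ) (x : ℕ → Vec d) (w : Vec d) : Vec d →L[ℝ] Vec d :=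
  (N : ℝ)⁻¹ • ∑ t ∈ Finset.range N, icaTermDeriv G w (sampleWhiten N x t)

theorem hasFDerivAt_hEmp (hG : ContDiff ℝ 3 G) (w : Vec d) :
    HasFDerivAt (hEmp G N x) (hEmpDeriv G N x w) w :=
  by
  have h := (HasFDerivAt.fun_sum (u := Finset.range N)
    fun t _ => hasFDerivAt_icaTerm hG w (sampleWhiten N x t)).const_smul (N : ℝ)⁻¹
  exact h

theorem hEmp_neg (hG : ∀ y, G (-y) = G y) (w : Vec d) : hEmp G N x (-w) = -hEmp G N x w := by
  simp only [hEmp_eq_sum_icaTerm, icaTerm_neg hG, Finset.sum_neg_distrib, smul_neg]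

theorem fEmp_neg (hG : ∀ y, G (-y) = G y) (w : Vec d) : fEmp G N x (-w) = -fEmp G N x w := by
  rw [fEmp, hEmp_neg N x hG, norm_neg, smul_neg, fEmp]

/-- The gradient is the average of `g(wᵀy) y`, which is the part subtracted in the field; the `g'`
terms only add a multiple of `w`. -/
theorem hasFDerivAt_contrastEmp (hG : ContDiff ℝ 3 G) (w : Vec d) :
    HasFDerivAt (contrastEmp G N x) (innerSL ℝ (((N : ℝ)⁻¹ * ∑ t ∈ Finset.range N,
      deriv (deriv G) (inner ℝ w (sampleWhiten N x t))) • w - hEmp G N x w)) w := by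
  have hi : ∀ y : Vec d, HasFDerivAt (fun w : Vec d => inner ℝ w y) (innerSL ℝ y) w := fun y => by
    convert! (innerSL ℝ y).hasFDerivAt (x := w) using 2 with x
    rw [innerSL_apply_apply, real_inner_comm]
  have h1 := fun y => ((hG.differentiable (by norm_num))
    (inner ℝ w y)).hasDerivAt.comp_hasFDerivAt w (hi y)
  have h2 := (HasFDerivAt.fun_sum (u := Finset.range N)
    fun t _ => h1 (sampleWhiten N x t)).const_mul (N : ℝ)⁻¹
  convert! h2 using 1
  ext u
  simp [hEmp, ← Finset.sum_smul]
  ring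

theorem norm_eq_one_of_mem_setF {v : Vec d} (hv : v ∈ setF G N x) : ‖v‖ = 1 := by
  have h1 : ‖fEmp G N x v‖ = 1 := by
    rw [fEmp, norm_smul, norm_inv, norm_norm, inv_mul_cancel₀ (norm_ne_zero_iff.2 hv.1)]
  rcases hv.2 with h | h <;> simpa [h] using h1

theorem setL_subset_setO (hG : ContDiff ℝ 3 G) : setL G N x ⊆ setO G N x := by
  rintro v ⟨hF, hd, hlt⟩
  have hv := norm_eq_one_of_mem_setF N x hF
  refine ⟨mem_sphere_zero_iff_norm.2 hv, ?_⟩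
  rcases hF.2 with h | h
  · exact isLocalExtrOn_sphere_of_norm_fderiv_lt_one (hasFDerivAt_contrastEmp N x hG) hv
      (Or.inl rfl) (by rw [one_smul]; exact h) hd hlt
  · exact isLocalExtrOn_sphere_of_norm_fderiv_lt_one (hasFDerivAt_contrastEmp N x hG) hv
      (Or.inr rfl) (by rw [neg_one_smul]; exact h) hd hlt

theorem setO_subset_setF (hG : ContDiff ℝ 3 G) (h0 : ∀ w ∈ unitSphere d, hEmp G N x w ≠ 0) :
    setO G N x ⊆ setF G N x := by
  rintro v ⟨hv, hext⟩
  refine ⟨h0 v hv, ?_⟩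
  exact norm_inv_smul_eq_of_eq_smul (h0 v hv) (mem_sphere_zero_iff_norm.1 hv)
    (eq_smul_of_isLocalExtrOn_sphere (hasFDerivAt_contrastEmp N x hG)
      (mem_sphere_zero_iff_norm.1 hv) hext)

end FastICA

/-! ### A locally uniform strong law. -/

section UniformLaw

variable {Ω P Y F : Type*} [MeasurableSpace Ω] {μ : Measure Ω} [TopologicalSpace P]
  [TopologicalSpace Y] [TopologicalSpace.PseudoMetrizableSpace Y] [SecondCountableTopology Y]
  [MeasurableSpace Y] [BorelSpace Y] [NormedAddCommGroup F] [NormedSpace ℝ F] [CompleteSpace F]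

/-- A locally uniform strong law of large numbers; the neighbourhood `U` is not random. -/
theorem exists_nhds_ae_eventually_average_mem {φ : P → Y → F}
    (hφ : Continuous fun q : P × Y => φ q.1 q.2) {X : ℕ → Ω → Y} {Z : Ω → Y}
    (hindep : Pairwise fun i j => IndepFun (X i) (X j) μ) (hident : ∀ t, IdentDistrib (X t) Z μ μ)
    {p₀ : P} {K : Set P} (hK : IsCompact K) (hK₀ : K ∈ 𝓝 p₀) {B : Ω → ℝ} (hB : Integrable B μ)
    (hdom : ∀ᵐ ω ∂μ, ∀ p ∈ K, ‖φ p (Z ω)‖ ≤ B ω) {W : Set F}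
    (hW : W ∈ 𝓝 (∫ ω, φ p₀ (Z ω) ∂μ)) :
    ∃ U ∈ 𝓝 p₀, ∀ᵐ ω ∂μ, ∀ᶠ N : ℕ in atTop, ∀ p ∈ U,
      (N : ℝ)⁻¹ • ∑ t ∈ Finset.range N, φ p (X t ω) ∈ W := by
  have : CompactSpace K := isCompact_iff_compactSpace.1 hK
  let : MeasurableSpace C(K, F) := borel _
  have : BorelSpace C(K, F) := ⟨rfl⟩
  have hp₀ : p₀ ∈ K := mem_of_mem_nhds hK₀
  -- Each data point becomes a random element of the Banach space `C(K, F)`, where the strong law is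
  -- uniform convergence on `K`.
  let Ψ : Y → C(K, F) := fun y => ⟨fun p => φ p y, by fun_prop⟩
  have hΨ : Continuous Ψ := ContinuousMap.continuous_of_continuous_uncurry Ψ
    (show Continuous fun q : Y × K => φ q.2 q.1 by fun_prop)
  have hZ : AEStronglyMeasurable Z μ := (hident 0).aemeasurable_snd.aestronglyMeasurable
  have hint : Integrable (fun ω => Ψ (Z ω)) μ := by
    refine hB.mono' (hΨ.comp_aestronglyMeasurable hZ) ?_
    filter_upwards [hdom] with ω hω
    exact (ContinuousMap.norm_le _ ((norm_nonneg _).trans (hω p₀ hp₀))).2 fun p => hω p p.2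
  have hidΨ : ∀ t, IdentDistrib (fun ω => Ψ (X t ω)) (fun ω => Ψ (Z ω)) μ μ :=
    fun t => (hident t).comp hΨ.measurable
  have hslln := strong_law_ae (fun t ω => Ψ (X t ω)) ((hidΨ 0).integrable_iff.2 hint)
    (fun i j hij => (hindep hij).comp hΨ.measurable hΨ.measurable)
    (fun t => (hidΨ t).trans (hidΨ 0).symm)
  rw [(hidΨ 0).integral_eq] at hslln
  set m : C(K, F) := ∫ ω, Ψ (Z ω) ∂μ with hm
  have hm₀ : m ⟨p₀, hp₀⟩ = ∫ ω, φ p₀ (Z ω) ∂μ :=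
    (ContinuousLinearMap.integral_comp_comm (ContinuousMap.evalCLM ℝ (⟨p₀, hp₀⟩ : K)) hint).symm
  rw [← hm₀] at hW
  -- Joint continuity of evaluation gives the neighbourhoods of `m` and `p₀` before any outcome is
  -- fixed, so `U` is not random.
  have hev : Tendsto (fun q : C(K, F) × K => q.1 q.2) (𝓝 m ×ˢ 𝓝 ⟨p₀, hp₀⟩)
      (𝓝 (m ⟨p₀, hp₀⟩)) := by
    rw [← nhds_prod_eq]
    exact (continuous_eval (F := C(K, F)) (X := K) (Y := F)).tendsto (m, ⟨p₀, hp₀⟩)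
  obtain ⟨M, hM, V, hV, hMV⟩ := mem_prod_iff.1 (hev hW)
  rw [nhds_subtype_eq_comap] at hV
  obtain ⟨V', hV', hVV'⟩ := mem_comap.1 hV
  refine ⟨V' ∩ K, inter_mem hV' hK₀, ?_⟩
  filter_upwards [hslln] with ω hω
  filter_upwards [hω hM] with N hN p hp
  have := hMV (Set.mk_mem_prod hN (hVV' (show (⟨p, hp.2⟩ : K) ∈ Subtype.val ⁻¹' V' from hp.1)))
  simpa [Ψ] using this

end UniformLaw

/-! ### The inverse square root, and convergence of the sample covariance. -/

namespace FastICA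

section InvSqrt

variable {d : ℕ} {M : Matrix (Fin d) (Fin d) ℝ}

theorem isHermitian_invSqrt (M : Matrix (Fin d) (Fin d) ℝ) : (invSqrt M).IsHermitian :=
  cfc_predicate (R := ℝ) (p := IsSelfAdjoint) _ M

theorem pos_of_mem_spectrum_of_posDef (hM : M.PosDef) {x : ℝ} (hx : x ∈ spectrum ℝ M) : 0 < x := by
  rw [hM.isHermitian.spectrum_real_eq_range_eigenvalues] at hx
  obtain ⟨i, rfl⟩ := hx
  exact hM.eigenvalues_pos i

theorem invSqrt_mul_mul_invSqrt (hM : M.PosDef) : invSqrt M * M * invSqrt M = 1 := by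
  have hsa : IsSelfAdjoint M := hM.isHermitian
  have hc : ContinuousOn (fun x : ℝ => (Real.sqrt x)⁻¹) (spectrum ℝ M) :=
    Real.continuous_sqrt.continuousOn.inv₀ fun x hx =>
      (Real.sqrt_pos.2 (pos_of_mem_spectrum_of_posDef hM hx)).ne'
  have h1 : invSqrt M * M = cfc (fun x : ℝ => (Real.sqrt x)⁻¹ * x) M := by
    rw [cfc_mul _ (fun x => x) M hc continuousOn_id, cfc_id' ℝ M]
    rfl
  rw [h1, invSqrt, ← cfc_mul (fun x : ℝ => (Real.sqrt x)⁻¹ * x) _ M (hc.mul continuousOn_id) hc,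
    cfc_congr (g := fun _ => (1 : ℝ)), cfc_const_one ℝ M]
  intro x hx
  have hx := pos_of_mem_spectrum_of_posDef hM hx
  have hs := Real.sqrt_pos.2 hx
  have := Real.mul_self_sqrt hx.le
  field_simp
  nlinarith

-- The scalar function is continuous away from 0, so the functional calculus is continuous on
-- invertible symmetric matrices.
open scoped Matrix.Norms.L2Operator in
theorem tendsto_invSqrt {C : ℕ → Matrix (Fin d) (Fin d) ℝ} (hC : ∀ n, (C n).IsHermitian)
    (hM : M.PosDef) (h : Tendsto C atTop (𝓝 M)) :
    Tendsto (fun n => invSqrt (C n)) atTop (𝓝 (invSqrt M)) := by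
  set t : Set (Matrix (Fin d) (Fin d) ℝ) := {M | IsSelfAdjoint M ∧ IsUnit M}
  have hcont : ContinuousOn (fun M : Matrix (Fin d) (Fin d) ℝ => invSqrt M) t := by
    refine ContinuousOn.cfc_of_mem_nhdsSet (p := IsSelfAdjoint) (s := {0}ᶜ)
      (fun x : ℝ => (Real.sqrt x)⁻¹) ?_ continuousOn_id (fun x hx => hx.1) ?_
    · refine isOpen_compl_singleton.mem_nhdsSet.2 ?_
      refine Set.iUnion₂_subset fun M hM x hx => ?_
      rintro rfl
      exact (spectrum.zero_notMem_iff ℝ).2 hM.2 hx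
    · refine fun x hx => ContinuousAt.continuousWithinAt ?_
      rcases lt_or_gt_of_ne (Set.mem_compl_singleton_iff.1 hx) with hx | hx
      -- On negative reals the square root is 0 by convention, and so is its inverse.
      · refine (continuousAt_const (y := (0 : ℝ))).congr ?_
        filter_upwards [Iio_mem_nhds hx] with y hy
        rw [Real.sqrt_eq_zero_of_nonpos (le_of_lt hy), inv_zero]
      · exact Real.continuous_sqrt.continuousAt.inv₀ (Real.sqrt_pos.2 hx).ne'
  have hMt : M ∈ t := ⟨hM.isHermitian, hM.isUnit⟩
  refine (hcont M hMt).tendsto.comp (tendsto_nhdsWithin_iff.2 ⟨h, ?_⟩)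
  filter_upwards [h.eventually (Units.isOpen.mem_nhds hM.isUnit)] with n hn
  exact ⟨hC n, hn⟩

end InvSqrt

section Covariance

variable {Ω : Type*} [MeasurableSpace Ω] {μ : Measure Ω} {d : ℕ}

theorem integrable_of_memLp_two [IsProbabilityMeasure μ] {x : Ω → Vec d}
    (hx : ∀ i, MemLp (fun ω => x ω i) 2 μ) : Integrable x μ := by
  have h : x = fun ω => ∑ i, x ω i • EuclideanSpace.basisFun (Fin d) ℝ i := by
    funext ω
    simpa using ((EuclideanSpace.basisFun (Fin d) ℝ).sum_repr (x ω)).symm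
  rw [h]
  exact integrable_finsetSum _ fun i _ => ((hx i).integrable one_le_two).smul_const _

theorem act_eq_toEuclideanCLM (M : Matrix (Fin d) (Fin d) ℝ) (v : Vec d) :
    act M v = Matrix.toEuclideanCLM (n := Fin d) (𝕜 := ℝ) M v := rfl

theorem act_apply (M : Matrix (Fin d) (Fin d) ℝ) (v : Vec d) (i : Fin d) :
    act M v i = ∑ j, M i j * v j := rfl

theorem isHermitian_sampleCov (N : ℕ) (x : ℕ → Vec d) : (sampleCov N x).IsHermitian := by
  ext i j
  simp [sampleCov, Matrix.vecMulVec_apply, Matrix.sum_apply, mul_comm]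

theorem sampleCov_apply {N : ℕ} (hN : N ≠ 0) (x : ℕ → Vec d) (i j : Fin d) :
    sampleCov N x i j = (N : ℝ)⁻¹ * ∑ t ∈ Finset.range N, x t i * x t j -
      sampleMean N x i * sampleMean N x j := by
  have hm : ∀ i, ∑ t ∈ Finset.range N, x t i = N * sampleMean N x i := fun i => by
    simp [sampleMean, hN]
  have h : sampleCov N x i j = (N : ℝ)⁻¹ * ∑ t ∈ Finset.range N,
      (x t i - sampleMean N x i) * (x t j - sampleMean N x j) := by
    simp [sampleCov, Matrix.vecMulVec_apply, Matrix.sum_apply]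
  have hN' : (N : ℝ) ≠ 0 := Nat.cast_ne_zero.2 hN
  simp only [h, sub_mul, mul_sub, Finset.sum_sub_distrib, ← Finset.mul_sum, ← Finset.sum_mul, hm,
    Finset.sum_const, Finset.card_range, nsmul_eq_mul]
  field_simp
  ring

theorem tendsto_sampleMean_sampleCov [IsProbabilityMeasure μ] {X : ℕ → Ω → Vec d} {x : Ω → Vec d}
    (hindep : Pairwise fun i j => IndepFun (X i) (X j) μ) (hident : ∀ t, IdentDistrib (X t) x μ μ)
    (hx : ∀ i, MemLp (fun ω => x ω i) 2 μ) :
    ∀ᵐ ω ∂μ, Tendsto (fun N => sampleMean N fun t => X t ω) atTop (𝓝 (∫ ω, x ω ∂μ)) ∧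
      Tendsto (fun N => sampleCov N fun t => X t ω) atTop (𝓝 (covMat x μ)) := by
  have hint : Integrable x μ := integrable_of_memLp_two hx
  have hmean := strong_law_ae X ((hident 0).integrable_iff.2 hint) hindep
    fun t => (hident t).trans (hident 0).symm
  have hprod : ∀ i j, ∀ᵐ ω ∂μ, Tendsto (fun N : ℕ => (N : ℝ)⁻¹ •
      ∑ t ∈ Finset.range N, X t ω i * X t ω j) atTop (𝓝 (∫ ω, x ω i * x ω j ∂μ)) := by
    intro i j
    have hm : Measurable fun v : Vec d => v i * v j := by fun_prop
    have hid : ∀ t, IdentDistrib (fun ω => X t ω i * X t ω j) (fun ω => x ω i * x ω j) μ μ :=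
      fun t => (hident t).comp hm
    have := strong_law_ae (fun t ω => X t ω i * X t ω j)
      ((hid 0).integrable_iff.2 ((hx i).integrable_mul (hx j)))
      (fun s t hst => (hindep hst).comp hm hm) fun t => (hid t).trans (hid 0).symm
    rwa [(hid 0).integral_eq] at this
  rw [(hident 0).integral_eq] at hmean
  have hprod' := ae_all_iff.2 fun i => ae_all_iff.2 (hprod i)
  have hcoord : ∀ i, (∫ ω, x ω ∂μ) i = ∫ ω, x ω i ∂μ := fun i =>
    ((EuclideanSpace.proj (𝕜 := ℝ) i).integral_comp_comm hint).symm
  filter_upwards [hmean, hprod'] with ω h1 h2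
  have h3 : Tendsto (fun N => sampleMean N fun t => X t ω) atTop (𝓝 (∫ ω, x ω ∂μ)) := h1
  refine ⟨h3, tendsto_pi_nhds.2 fun i => tendsto_pi_nhds.2 fun j => ?_⟩
  have h4 : ∀ i, Tendsto (fun N => (sampleMean N fun t => X t ω) i) atTop (𝓝 (∫ ω, x ω i ∂μ)) :=
    fun i => hcoord i ▸ ((EuclideanSpace.proj (𝕜 := ℝ) i).continuous.tendsto _).comp h3
  have h5 : covMat x μ i j = ∫ ω, x ω i * x ω j ∂μ - (∫ ω, x ω i ∂μ) * ∫ ω, x ω j ∂μ :=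
    covariance_eq_sub (hx i) (hx j)
  rw [h5]
  refine ((h2 i j).sub ((h4 i).mul (h4 j))).congr' ?_
  filter_upwards [eventually_ne_atTop 0] with N hN
  rw [sampleCov_apply hN, smul_eq_mul]

end Covariance

/-! ### Covariance of the observation. -/

section Model

variable {Ω : Type*} [MeasurableSpace Ω] {μ : Measure Ω} {d : ℕ}
  {A : Matrix (Fin d) (Fin d) ℝ} {s : Ω → Vec d}

theorem memLp_observe (hs : IsSource s μ) (A : Matrix (Fin d) (Fin d) ℝ) (i : Fin d) :
    MemLp (fun ω => observe A s ω i) 2 μ := by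
  have : (fun ω => observe A s ω i) = fun ω => ∑ j, A i j * s ω j := rfl
  rw [this]
  exact memLp_finsetSum _ fun j _ => (hs.memLp j).const_mul _

theorem covMat_observe [IsProbabilityMeasure μ] (hs : IsSource s μ) (A : Matrix (Fin d) (Fin d) ℝ) :
    covMat (observe A s) μ = A * Aᵀ := by
  ext i j
  have h : covMat (observe A s) μ i j =
      cov[fun ω => ∑ k, A i k * s ω k, fun ω => ∑ l, A j l * s ω l; μ] := rfl
  rw [h, covariance_fun_sum_fun_sum (fun k => (hs.memLp k).const_mul _)
    (fun l => (hs.memLp l).const_mul _), Matrix.mul_apply]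
  refine Finset.sum_congr rfl fun k _ => ?_
  rw [Finset.sum_eq_single k]
  · rw [covariance_const_mul_left, covariance_const_mul_right, covariance_self
      (hs.memLp k).aestronglyMeasurable.aemeasurable, hs.unit_variance k, mul_one,
      Matrix.transpose_apply]
  · intro l _ hl
    rw [covariance_const_mul_left, covariance_const_mul_right,
      (hs.indep.indepFun hl.symm).covariance_eq_zero (hs.memLp k) (hs.memLp l), mul_zero, mul_zero]
  · simp

theorem posDef_mul_transpose (hA : IsUnit A.det) : (A * Aᵀ).PosDef := by
  rw [← Matrix.conjTranspose_eq_transpose_of_trivial]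
  exact Matrix.PosDef.mul_conjTranspose_self A
    (Matrix.vecMul_injective_of_isUnit ((Matrix.isUnit_iff_isUnit_det A).2 hA))

end Model

end FastICA

/-! ### The population field and its derivative at a demixing vector. -/

section Population

variable {Ω E ι : Type*} [MeasurableSpace Ω] {μ : Measure Ω} [NormedAddCommGroup E]
  [InnerProductSpace ℝ E] [Fintype ι] {G : ℝ → ℝ}

theorem OrthonormalBasis.eq_smul_of_inner_eq_zero (b : OrthonormalBasis ι ℝ E) {i : ι} {x : E}
    (h : ∀ j, j ≠ i → inner ℝ (b j) x = 0) : x = inner ℝ (b i) x • b i := by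
  conv_lhs => rw [← b.sum_repr' x]
  refine Finset.sum_eq_single i (fun j _ hj => ?_) (by simp)
  rw [h j hj, zero_smul]

variable [CompleteSpace E] [MeasurableSpace E] [BorelSpace E] {b : OrthonormalBasis ι ℝ E}
  {z : Ω → E}

/-- At a direction along which the coordinate is independent of the others, the expected FastICA
field is radial. -/
theorem integral_icaTerm_eq_smul (hG : ContDiff ℝ 3 G) (hz : AEMeasurable z μ)
    (hind : iIndepFun (fun j ω => inner ℝ (b j) (z ω)) μ)
    (hmean : ∀ j, ∫ ω, inner ℝ (b j) (z ω) ∂μ = 0) (i : ι)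
    (hint : Integrable (fun ω => icaTerm G (b i) (z ω)) μ) :
    ∃ c : ℝ, ∫ ω, icaTerm G (b i) (z ω) ∂μ = c • b i := by
  have hm : ∀ j, AEMeasurable (fun ω => inner ℝ (b j) (z ω)) μ := fun j =>
    (innerSL ℝ (b j)).continuous.measurable.comp_aemeasurable hz
  have hg : Measurable (deriv G) := (contDiff_two_deriv hG).continuous.measurable
  refine ⟨_, b.eq_smul_of_inner_eq_zero fun j hj => ?_⟩
  rw [← integral_inner hint]
  have h : ∀ ω, inner ℝ (b j) (icaTerm G (b i) (z ω)) =
      -(deriv G (inner ℝ (b i) (z ω)) * inner ℝ (b j) (z ω)) := fun ω => by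
    rw [icaTerm, inner_sub_right, inner_smul_right, inner_smul_right, b.inner_eq_zero hj]
    ring
  simp only [h]
  rw [integral_neg, IndepFun.integral_fun_mul_eq_mul_integral
    (X := fun ω => deriv G (inner ℝ (b i) (z ω))) (Y := fun ω => inner ℝ (b j) (z ω))
    ((hind.indepFun hj.symm).comp hg measurable_id)
    (hg.comp_aemeasurable (hm i)).aestronglyMeasurable (hm j).aestronglyMeasurable,
    hmean j, mul_zero, neg_zero]

/-- At such a direction the expected derivative of the FastICA field has rank at most one. -/
theorem integral_icaTermDeriv_apply_eq_smul (hG : ContDiff ℝ 3 G) (hz : AEMeasurable z μ)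
    [IsProbabilityMeasure μ]
    (hind : iIndepFun (fun j ω => inner ℝ (b j) (z ω)) μ)
    (hL2 : ∀ j, MemLp (fun ω => inner ℝ (b j) (z ω)) 2 μ)
    (hmean : ∀ j, ∫ ω, inner ℝ (b j) (z ω) ∂μ = 0)
    (hvar : ∀ j, ∫ ω, inner ℝ (b j) (z ω) ^ 2 ∂μ = 1) (i : ι)
    (hint : Integrable (fun ω => icaTermDeriv G (b i) (z ω)) μ) (u : E) :
    ∃ c : ℝ, (∫ ω, icaTermDeriv G (b i) (z ω) ∂μ) u = c • b i := by
  classical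
  have hm : ∀ j, AEMeasurable (fun ω => inner ℝ (b j) (z ω)) μ := fun j =>
    (innerSL ℝ (b j)).continuous.measurable.comp_aemeasurable hz
  have hg : Measurable (deriv (deriv G)) := (contDiff_one_deriv_deriv hG).continuous.measurable
  refine ⟨_, b.eq_smul_of_inner_eq_zero fun j hj => ?_⟩
  set T := ∫ ω, icaTermDeriv G (b i) (z ω) ∂μ with hT
  suffices h : (innerSL ℝ (b j)).comp T = 0 by
    simpa using congrArg (fun L : E →L[ℝ] ℝ => L u) h
  suffices h : ((innerSL ℝ (b j)).comp T : E →ₗ[ℝ] ℝ) = 0 by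
    ext x
    exact congrArg (fun L : E →ₗ[ℝ] ℝ => L x) h
  refine b.toBasis.ext fun k => ?_
  suffices h : inner ℝ (b j) (T (b k)) = 0 by simpa using h
  have hint' : Integrable (fun ω => icaTermDeriv G (b i) (z ω) (b k)) μ :=
    hint.apply_continuousLinearMap (b k)
  rw [hT, ContinuousLinearMap.integral_apply hint, ← integral_inner hint']
  have h : ∀ ω, inner ℝ (b j) (icaTermDeriv G (b i) (z ω) (b k)) =
      deriv (deriv G) (inner ℝ (b i) (z ω)) * ((if j = k then 1 else 0) -
        inner ℝ (b k) (z ω) * inner ℝ (b j) (z ω)) := fun ω => by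
    rw [icaTermDeriv_apply, inner_add_right, inner_smul_right, inner_smul_right, inner_sub_right,
      inner_smul_right, b.inner_eq_zero hj, b.inner_eq_ite, real_inner_comm (b k)]
    ring
  simp only [h]
  -- For `j = k` unit variance kills the factor `1 - z_j ^ 2`. Otherwise `z_j` is centered and
  -- independent of the pair `(z_i, z_k)`, the case `k = i` included.
  by_cases hjk : j = k
  · subst hjk
    have hms : Measurable fun y : ℝ => 1 - y * y := by fun_prop
    rw [if_pos rfl, IndepFun.integral_fun_mul_eq_mul_integral
      (X := fun ω => deriv (deriv G) (inner ℝ (b i) (z ω)))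
      (Y := fun ω => 1 - inner ℝ (b j) (z ω) * inner ℝ (b j) (z ω))
      ((hind.indepFun hj.symm).comp hg hms)
      (hg.comp_aemeasurable (hm i)).aestronglyMeasurable
      (hms.comp_aemeasurable (hm j)).aestronglyMeasurable]
    have h1 : ∫ ω, (1 - inner ℝ (b j) (z ω) * inner ℝ (b j) (z ω)) ∂μ = 0 := by
      have hsq : Integrable (fun ω => inner ℝ (b j) (z ω) * inner ℝ (b j) (z ω)) μ :=
        (hL2 j).integrable_mul (hL2 j)
      rw [integral_sub (integrable_const _) hsq]
      have := hvar j
      simp only [sq] at this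
      simp [this]
    rw [h1, mul_zero]
  · have hms : Measurable fun y : ℝ × ℝ => deriv (deriv G) y.1 * y.2 := by fun_prop
    have h2 : ∀ ω, deriv (deriv G) (inner ℝ (b i) (z ω)) * ((if j = k then 1 else 0) -
        inner ℝ (b k) (z ω) * inner ℝ (b j) (z ω)) =
        -((deriv (deriv G) (inner ℝ (b i) (z ω)) * inner ℝ (b k) (z ω)) *
          inner ℝ (b j) (z ω)) := fun ω => by
      rw [if_neg hjk]; ring
    simp only [h2]
    rw [integral_neg, IndepFun.integral_fun_mul_eq_mul_integral
      (X := fun ω => deriv (deriv G) (inner ℝ (b i) (z ω)) * inner ℝ (b k) (z ω))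
      (Y := fun ω => inner ℝ (b j) (z ω))
      ((hind.indepFun_prodMk₀ hm i k j hj.symm (Ne.symm hjk)).comp hms measurable_id)
      (hms.comp_aemeasurable ((hm i).prodMk (hm k))).aestronglyMeasurable
      (hm j).aestronglyMeasurable, hmean j, mul_zero, neg_zero]

end Population

namespace FastICA

/-! ### The orthonormal basis of demixing vectors. -/

section Demix

variable {Ω : Type*} [MeasurableSpace Ω] {μ : Measure Ω} {d : ℕ}
  {A : Matrix (Fin d) (Fin d) ℝ} {s : Ω → Vec d}

theorem transpose_mul_self_invSqrt_mul (hA : IsUnit A.det) :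
    (invSqrt (A * Aᵀ) * A)ᵀ * (invSqrt (A * Aᵀ) * A) = 1 := by
  rw [mul_eq_one_comm, Matrix.transpose_mul,
    ← Matrix.conjTranspose_eq_transpose_of_trivial (invSqrt _), (isHermitian_invSqrt _).eq]
  have := invSqrt_mul_mul_invSqrt (posDef_mul_transpose hA)
  simpa only [Matrix.mul_assoc] using this

theorem orthonormal_demix (hA : IsUnit A.det) : Orthonormal ℝ (demix A) := by
  rw [orthonormal_iff_ite]
  intro i j
  have := congrFun (congrFun (transpose_mul_self_invSqrt_mul hA) i) j
  rw [Matrix.one_apply, Matrix.mul_apply] at this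
  rw [← this, PiLp.inner_apply]
  refine Finset.sum_congr rfl fun k _ => ?_
  simp [demix, mul_comm]

/-- The demixing vectors as an orthonormal basis. -/
noncomputable def demixBasis (hA : IsUnit A.det) : OrthonormalBasis (Fin d) ℝ (Vec d) :=
  OrthonormalBasis.mk (orthonormal_demix hA)
    ((orthonormal_demix hA).linearIndependent.span_eq_top_of_card_eq_finrank' (by simp)).ge

theorem demixBasis_apply (hA : IsUnit A.det) (i : Fin d) : demixBasis hA i = demix A i := by
  simp [demixBasis]

theorem inner_demix_act (hA : IsUnit A.det) (j : Fin d) (v : Vec d) :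
    inner ℝ (demix A j) (act (invSqrt (A * Aᵀ) * A) v) = v j := by
  have h : act (invSqrt (A * Aᵀ) * A) v = ∑ l, v l • demix A l := by
    ext k
    simp [act_apply, demix, mul_comm]
  rw [h, (orthonormal_demix hA).inner_right_fintype]

theorem whiten_observe [IsProbabilityMeasure μ] (hs : IsSource s μ) (ω : Ω) :
    whiten (observe A s) μ ω = act (invSqrt (A * Aᵀ) * A) (s ω - ∫ ω, s ω ∂μ) := by
  have h : ∫ ω, observe A s ω ∂μ = act A (∫ ω, s ω ∂μ) := by
    have := (Matrix.toEuclideanCLM (n := Fin d) (𝕜 := ℝ) A).integral_comp_comm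
      (integrable_of_memLp_two hs.memLp)
    exact this
  rw [whiten, covMat_observe hs, h, observe]
  simp only [act_eq_toEuclideanCLM, map_mul, map_sub, mul_apply_eq_comp]

/-- The whitened mixing matrix is orthogonal with columns `demix A j`, so pairing with a column
undoes the mixing. This is how independence of the sources enters. -/
theorem inner_demix_whiten [IsProbabilityMeasure μ] (hs : IsSource s μ) (hA : IsUnit A.det)
    (j : Fin d) (ω : Ω) :
    inner ℝ (demix A j) (whiten (observe A s) μ ω) = s ω j - ∫ ω, s ω j ∂μ := by
  rw [whiten_observe hs, inner_demix_act hA, PiLp.sub_apply]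
  congr 1
  exact ((EuclideanSpace.proj (𝕜 := ℝ) j).integral_comp_comm
    (integrable_of_memLp_two hs.memLp)).symm

end Demix

end FastICA

namespace FastICA

/-! ### Stability of the domination assumption. -/

section Domination

variable {Ω : Type*} [MeasurableSpace Ω] {μ : Measure Ω} {d : ℕ} {G : ℝ → ℝ}

/-- The domination assumption carries over to data whitened by a nearby matrix and centered at a
nearby point. -/
theorem exists_compact_nhds_dominated {x : Ω → Vec d} {R₀ T : Vec d →L[ℝ] Vec d} {e : Vec d}
    (hRT : R₀ * T = 1) (hTR : T * R₀ = 1) (hdom : Dominated G (fun ω => R₀ (x ω - e)) μ)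
    {w₀ : Vec d} (hw₀ : ‖w₀‖ = 1) :
    ∃ K ∈ 𝓝 (w₀, R₀, e), IsCompact K ∧ ∃ B : Ω → ℝ, Integrable B μ ∧ ∀ᵐ ω ∂μ, ∀ p ∈ K,
      ‖icaTerm G p.1 (p.2.1 (x ω - p.2.2))‖ ≤ B ω ∧
      ‖icaTermDeriv G p.1 (p.2.1 (x ω - p.2.2))‖ ≤ B ω := by
  obtain ⟨δ, hδ, B, hB, hBdom⟩ := hdom
  -- With `z = R₀ (x - e)` and `p = (w, R, e')`, `wᵀR(x - e') = ((RT)ᵀw)ᵀz + wᵀR(e - e')`: a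
  -- perturbed direction `w'` and a small shift, as `Dominated` permits.
  let w' : Vec d × (Vec d →L[ℝ] Vec d) × Vec d → Vec d := fun p =>
    ContinuousLinearMap.adjoint (p.2.1 * T) p.1
  let c : Vec d × (Vec d →L[ℝ] Vec d) × Vec d → Vec d := fun p => p.2.1 (e - p.2.2)
  have hw' : Continuous w' := by
    have : Continuous fun p : Vec d × (Vec d →L[ℝ] Vec d) × Vec d =>
        ContinuousLinearMap.adjoint (p.2.1 * T) :=
      ContinuousLinearMap.adjoint.continuous.comp (by fun_prop)
    exact this.clm_apply continuous_fst
  have hc : Continuous c := by fun_prop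
  have hRTc : Continuous fun p : Vec d × (Vec d →L[ℝ] Vec d) × Vec d => ‖p.2.1 * T‖ := by fun_prop
  set p₀ : Vec d × (Vec d →L[ℝ] Vec d) × Vec d := (w₀, R₀, e) with hp₀
  have h1 : ∀ᶠ p in 𝓝 p₀, |‖w' p‖ - 1| < δ := by
    refine ContinuousAt.eventually_lt (by fun_prop) continuousAt_const ?_
    have : w' p₀ = w₀ := by
      simp only [w', hp₀, hRT, ← ContinuousLinearMap.star_eq_adjoint, star_one]
      rfl
    rw [this, hw₀]; simpa using hδ
  have h2 : ∀ᶠ p in 𝓝 p₀, |inner ℝ p.1 (c p)| < δ := by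
    refine ContinuousAt.eventually_lt (by fun_prop) continuousAt_const ?_
    simpa [c, hp₀] using hδ
  have h3 : ∀ᶠ p in 𝓝 p₀, ‖p.2.1 * T‖ < 2 := by
    refine ContinuousAt.eventually_lt hRTc.continuousAt continuousAt_const ?_
    simp only [hp₀, hRT]
    exact ContinuousLinearMap.norm_id_le.trans_lt one_lt_two
  have h4 : ∀ᶠ p in 𝓝 p₀, ‖c p‖ < 1 := by
    refine ContinuousAt.eventually_lt (by fun_prop) continuousAt_const ?_
    simp [c, hp₀]
  have h5 : ∀ᶠ p in 𝓝 p₀, ‖p.1‖ < 2 := by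
    refine ContinuousAt.eventually_lt (by fun_prop) continuousAt_const ?_
    simp [hp₀, hw₀]
  have : ProperSpace (Vec d →L[ℝ] Vec d) := FiniteDimensional.proper ℝ _
  obtain ⟨K, hK, hKsub, hKc⟩ := local_compact_nhds (h1.and (h2.and (h3.and (h4.and h5))))
  -- The derivative needs `4 B` for the `g''` term and `5 B` for the `g'` term; the field itself
  -- needs only `4 B`.
  refine ⟨K, hK, hKc, fun ω => 9 * B ω, hB.const_mul 9, ?_⟩
  filter_upwards [hBdom] with ω hω p hp
  obtain ⟨k1, k2, k3, k4, k5⟩ := hKsub hp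
  set z := R₀ (x ω - e) with hz
  have hy : p.2.1 (x ω - p.2.2) = (p.2.1 * T) z + c p := by
    have : T z = x ω - e := by
      rw [hz, ← ContinuousLinearMap.comp_apply]
      exact congrArg (fun L : Vec d →L[ℝ] Vec d => L (x ω - e)) hTR
    rw [mul_apply_eq_comp, this, ← map_add]
    congr 1; abel
  have hin : inner ℝ p.1 (p.2.1 (x ω - p.2.2)) = inner ℝ (w' p) z + inner ℝ p.1 (c p) := by
    rw [hy, inner_add_right, ContinuousLinearMap.adjoint_inner_left]
  have hny : ‖p.2.1 (x ω - p.2.2)‖ ≤ 2 * (1 + ‖z‖) := by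
    rw [hy]
    have := (p.2.1 * T).le_opNorm z
    refine (norm_add_le _ _).trans ?_
    nlinarith [norm_nonneg z]
  obtain ⟨b1, b2, b3⟩ := hω (w' p) (inner ℝ p.1 (c p)) k1.le k2.le
  rw [← hin] at b1 b2 b3
  set y := p.2.1 (x ω - p.2.2)
  have hz0 := norm_nonneg z
  have hy0 := norm_nonneg y
  have hw0 := norm_nonneg p.1
  set g0 := |deriv G (inner ℝ p.1 y)|
  set g1 := |deriv (deriv G) (inner ℝ p.1 y)|
  set g2 := |deriv (deriv (deriv G)) (inner ℝ p.1 y)|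
  have hg0 : 0 ≤ g0 := abs_nonneg _
  have hg1 : 0 ≤ g1 := abs_nonneg _
  have hg2 : 0 ≤ g2 := abs_nonneg _
  have hB0 : 0 ≤ B ω := le_trans (by positivity) b1
  have c1 : g1 ≤ B ω := le_trans (le_mul_of_one_le_right hg1 (by nlinarith)) b2
  constructor
  · refine (norm_icaTerm_le _ _).trans ?_
    have e1 : g1 * ‖p.1‖ ≤ g1 * 2 := mul_le_mul_of_nonneg_left k5.le hg1
    have e2 : g0 * ‖y‖ ≤ g0 * (2 * (1 + ‖z‖)) := mul_le_mul_of_nonneg_left hny hg0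
    linarith
  · refine (norm_icaTermDeriv_le _ _).trans ?_
    have e1 : g2 * (‖y‖ * ‖p.1‖) ≤ g2 * (2 * (1 + ‖z‖) * 2) :=
      mul_le_mul_of_nonneg_left (mul_le_mul hny k5.le hw0 (by positivity)) hg2
    have e2 : g1 * (1 + ‖y‖ ^ 2) ≤ g1 * (1 + (2 * (1 + ‖z‖)) ^ 2) :=
      mul_le_mul_of_nonneg_left (by gcongr) hg1
    nlinarith

end Domination

end FastICA

namespace FastICA

/-! ### Convergence of the empirical field and its derivative. -/

section Empirical

variable {Ω : Type*} [MeasurableSpace Ω] {μ : Measure Ω} [IsProbabilityMeasure μ] {d : ℕ}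
  {G : ℝ → ℝ} {X : ℕ → Ω → Vec d} {x : Ω → Vec d} {w₀ : Vec d}

/-- The FastICA map is odd, so its derivatives at `v` and `-v` coincide. -/
theorem neg_mem_setL (hG : ∀ y, G (-y) = G y) {N : ℕ} {x : ℕ → Vec d} {v : Vec d}
    (hv : v ∈ setL G N x) : -v ∈ setL G N x := by
  obtain ⟨⟨h0, hfix⟩, hd, hlt⟩ := hv
  have hodd : fEmp G N x = fun w => -fEmp G N x (-w) := by
    funext w; rw [fEmp_neg N x hG, neg_neg]
  have hd' : HasFDerivAt (fEmp G N x) (fderiv ℝ (fEmp G N x) v) (-v) := by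
    have h1 : HasFDerivAt (fEmp G N x) (fderiv ℝ (fEmp G N x) v) (-(-v)) := by
      rw [neg_neg]; exact hd.hasFDerivAt
    have h2 := (h1.comp (-v) (hasFDerivAt_id (-v)).neg).neg
    rw [hodd]
    convert! h2 using 1
    rw [← hodd]
    ext u
    simp
  refine ⟨⟨?_, ?_⟩, hd'.differentiableAt, ?_⟩
  · rw [hEmp_neg N x hG]; exact neg_ne_zero.2 h0
  · rw [fEmp_neg N x hG]
    exact hfix.imp (congrArg _) (congrArg _)
  · rwa [hd'.fderiv]

/-- A locally uniform strong law for averages over empirically whitened data. -/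
theorem exists_closedBall_ae_eventually_average_mem {F : Type*} [NormedAddCommGroup F]
    [NormedSpace ℝ F] [CompleteSpace F] {ψ : Vec d → Vec d → F}
    (hψ : Continuous fun p : Vec d × Vec d => ψ p.1 p.2)
    (hindep : Pairwise fun i j => IndepFun (X i) (X j) μ) (hident : ∀ t, IdentDistrib (X t) x μ μ)
    (hx : ∀ i, MemLp (fun ω => x ω i) 2 μ) (hpos : (covMat x μ).PosDef)
    {K : Set (Vec d × (Vec d →L[ℝ] Vec d) × Vec d)} (hK : IsCompact K)
    (hK₀ : K ∈ 𝓝 (w₀, (Matrix.toEuclideanCLM (n := Fin d) (𝕜 := ℝ) (invSqrt (covMat x μ)) :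
      Vec d →L[ℝ] Vec d), ∫ ω, x ω ∂μ))
    {B : Ω → ℝ} (hB : Integrable B μ)
    (hdom : ∀ᵐ ω ∂μ, ∀ p ∈ K, ‖ψ p.1 (p.2.1 (x ω - p.2.2))‖ ≤ B ω)
    {W : Set F} (hW : W ∈ 𝓝 (∫ ω, ψ w₀ (whiten x μ ω) ∂μ)) :
    ∃ r > 0, ∀ᵐ ω ∂μ, ∀ᶠ N : ℕ in atTop, ∀ w ∈ Metric.closedBall w₀ r,
      (N : ℝ)⁻¹ • ∑ t ∈ Finset.range N, ψ w (sampleWhiten N (fun t => X t ω) t) ∈ W := by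
  obtain ⟨U, hU, hae⟩ := exists_nhds_ae_eventually_average_mem
    (φ := fun (p : Vec d × (Vec d →L[ℝ] Vec d) × Vec d) y => ψ p.1 (p.2.1 (y - p.2.2)))
    (hψ.comp (by fun_prop : Continuous fun q : (Vec d × (Vec d →L[ℝ] Vec d) × Vec d) × Vec d =>
      (q.1.1, q.1.2.1 (q.2 - q.1.2.2)))) hindep hident hK hK₀ hB hdom hW
  rw [nhds_prod_eq] at hU
  obtain ⟨U₁, hU₁, U₂, hU₂, hsub⟩ := mem_prod_iff.1 hU
  obtain ⟨r, hr, hball⟩ := Metric.nhds_basis_closedBall.mem_iff.1 hU₁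
  refine ⟨r, hr, ?_⟩
  filter_upwards [hae, tendsto_sampleMean_sampleCov hindep hident hx] with ω h1 ⟨h2, h3⟩
  have h4 := tendsto_invSqrt (fun N => isHermitian_sampleCov N _) hpos h3
  have hcont : Continuous fun M : Matrix (Fin d) (Fin d) ℝ =>
      (Matrix.toEuclideanCLM (n := Fin d) (𝕜 := ℝ) M : Vec d →L[ℝ] Vec d) :=
    LinearMap.continuous_of_finiteDimensional
      (Matrix.toEuclideanCLM (n := Fin d) (𝕜 := ℝ)).toAlgEquiv.toLinearMap
  have h5 := ((hcont.tendsto _).comp h4).prodMk_nhds h2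
  -- The random whitening matrix and mean eventually enter `U₂`, while the ball of directions inside
  -- `U₁` stays fixed.
  filter_upwards [h1, h5 hU₂] with N hN hN' w hw
  exact hN _ (hsub (Set.mk_mem_prod (hball hw) hN'))

theorem exists_closedBall_ae_eventually_hEmp_mem (hG : ContDiff ℝ 3 G)
    (hindep : Pairwise fun i j => IndepFun (X i) (X j) μ) (hident : ∀ t, IdentDistrib (X t) x μ μ)
    (hx : ∀ i, MemLp (fun ω => x ω i) 2 μ) (hpos : (covMat x μ).PosDef)
    (hdom : Dominated G (whiten x μ) μ) (hw₀ : ‖w₀‖ = 1) :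
    Integrable (fun ω => icaTerm G w₀ (whiten x μ ω)) μ ∧
    Integrable (fun ω => icaTermDeriv G w₀ (whiten x μ ω)) μ ∧
    (∀ W ∈ 𝓝 (hPop G (whiten x μ) μ w₀), ∃ r > 0, ∀ᵐ ω ∂μ, ∀ᶠ N : ℕ in atTop,
      ∀ w ∈ Metric.closedBall w₀ r, hEmp G N (fun t => X t ω) w ∈ W) ∧
    ∀ W ∈ 𝓝 (∫ ω, icaTermDeriv G w₀ (whiten x μ ω) ∂μ), ∃ r > 0, ∀ᵐ ω ∂μ, ∀ᶠ N : ℕ in atTop,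
      ∀ w ∈ Metric.closedBall w₀ r, hEmpDeriv G N (fun t => X t ω) w ∈ W := by
  set R₀ : Vec d →L[ℝ] Vec d :=
    Matrix.toEuclideanCLM (n := Fin d) (𝕜 := ℝ) (invSqrt (covMat x μ)) with hR₀
  have hone := invSqrt_mul_mul_invSqrt hpos
  -- The inverse of the whitening map.
  set T : Vec d →L[ℝ] Vec d :=
    Matrix.toEuclideanCLM (n := Fin d) (𝕜 := ℝ) (covMat x μ * invSqrt (covMat x μ)) with hT
  have hRT : R₀ * T = 1 := by rw [hR₀, hT, ← map_mul, ← Matrix.mul_assoc, hone, map_one]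
  have hTR : T * R₀ = 1 := by
    rw [hR₀, hT, ← map_mul, mul_eq_one_comm.1 ((Matrix.mul_assoc _ _ _).symm.trans hone), map_one]
  obtain ⟨K, hK₀, hK, B, hB, hKdom⟩ := exists_compact_nhds_dominated hRT hTR hdom hw₀
  have hmem := mem_of_mem_nhds hK₀
  have hxm : AEStronglyMeasurable x μ := (hident 0).aemeasurable_snd.aestronglyMeasurable
  have hzm : AEStronglyMeasurable (whiten x μ) μ :=
    R₀.continuous.comp_aestronglyMeasurable (hxm.sub aestronglyMeasurable_const)
  refine ⟨hB.mono' (((continuous_icaTerm hG).comp (by fun_prop : Continuous fun y : Vec d =>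
      (w₀, y))).comp_aestronglyMeasurable hzm) ?_,
    hB.mono' (((continuous_icaTermDeriv hG).comp (by fun_prop : Continuous fun y : Vec d =>
      (w₀, y))).comp_aestronglyMeasurable hzm) ?_, fun W hW => ?_, fun W hW => ?_⟩
  · filter_upwards [hKdom] with ω hω using (hω _ hmem).1
  · filter_upwards [hKdom] with ω hω using (hω _ hmem).2
  · exact exists_closedBall_ae_eventually_average_mem (continuous_icaTerm hG) hindep hident hx hpos
      hK hK₀ hB (hKdom.mono fun ω h p hp => (h p hp).1) hW
  · exact exists_closedBall_ae_eventually_average_mem (continuous_icaTermDeriv hG) hindep hident hx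
      hpos hK hK₀ hB (hKdom.mono fun ω h p hp => (h p hp).2) hW

/-- Finitely many of the local balls cover the compact sphere, so finitely many null sets and
thresholds in `N` suffice. -/
theorem ae_eventually_hEmp_ne_zero (hG : ContDiff ℝ 3 G)
    (hindep : Pairwise fun i j => IndepFun (X i) (X j) μ) (hident : ∀ t, IdentDistrib (X t) x μ μ)
    (hx : ∀ i, MemLp (fun ω => x ω i) 2 μ) (hpos : (covMat x μ).PosDef)
    (hdom : Dominated G (whiten x μ) μ)
    (hh : ∀ w ∈ unitSphere d, hPop G (whiten x μ) μ w ≠ 0) :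
    ∀ᵐ ω ∂μ, ∀ᶠ N : ℕ in atTop, ∀ w ∈ unitSphere d, hEmp G N (fun t => X t ω) w ≠ 0 := by
  have hloc : ∀ w ∈ unitSphere d, ∃ r > 0, ∀ᵐ ω ∂μ, ∀ᶠ N : ℕ in atTop,
      ∀ v ∈ Metric.closedBall w r, hEmp G N (fun t => X t ω) v ∈ ({0}ᶜ : Set (Vec d)) :=
    fun w hw => (exists_closedBall_ae_eventually_hEmp_mem hG hindep hident hx hpos hdom
      (mem_sphere_zero_iff_norm.1 hw)).2.2.1 _ (isOpen_compl_singleton.mem_nhds (hh w hw))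
  choose! r hr hae using hloc
  obtain ⟨t, ht, hcover⟩ := (isCompact_sphere (0 : Vec d) 1).elim_nhds_subcover
    (fun w => Metric.closedBall w (r w)) fun w hw => Metric.closedBall_mem_nhds w (hr w hw)
  have hall : ∀ᵐ ω ∂μ, ∀ w ∈ t, ∀ᶠ N : ℕ in atTop,
      ∀ v ∈ Metric.closedBall w (r w), hEmp G N (fun t => X t ω) v ∈ ({0}ᶜ : Set (Vec d)) :=
    (Finset.eventually_all t).2 fun w hw => hae w (ht w hw)
  filter_upwards [hall] with ω hω
  filter_upwards [(Finset.eventually_all t).2 hω] with N hN w hw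
  obtain ⟨v, hv, hwv⟩ := Set.mem_iUnion₂.1 (hcover hw)
  exact hN v hv w hwv

end Empirical

/-! ### The attractive fixed point near a demixing vector. -/

section Attraction

variable {Ω : Type*} [MeasurableSpace Ω] {μ : Measure Ω} {d : ℕ} {G : ℝ → ℝ}
  {X : ℕ → Ω → Vec d} {a h₀ : Vec d} {T : Vec d →L[ℝ] Vec d}

theorem hasFDerivAt_fEmp (hG : ContDiff ℝ 3 G) {N : ℕ} {x : ℕ → Vec d} {w : Vec d}
    (h0 : hEmp G N x w ≠ 0) :
    HasFDerivAt (fEmp G N x) ((fderiv ℝ (fun y : Vec d => ‖y‖⁻¹ • y) (hEmp G N x w)).comp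
      (hEmpDeriv G N x w)) w := by
  have h1 := ((contDiffAt_norm_inv_smul h0).differentiableAt (by norm_num)).hasFDerivAt
  exact h1.comp w (hasFDerivAt_hEmp N x hG w)

/-- The range of `T` is radial at `h₀`, so the limiting derivative of the normalized field is 0; it
depends continuously on field and derivative near `(h₀, T)`. -/
theorem exists_closedBall_ae_eventually_norm_fderiv_fEmp_le (hG : ContDiff ℝ 3 G) (hh₀ : h₀ ≠ 0)
    (hT : ∀ u, ∃ c : ℝ, T u = c • h₀)
    (h : ∀ W ∈ 𝓝 h₀, ∃ r > 0, ∀ᵐ ω ∂μ, ∀ᶠ N : ℕ in atTop,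
      ∀ w ∈ Metric.closedBall a r, hEmp G N (fun t => X t ω) w ∈ W)
    (h' : ∀ W ∈ 𝓝 T, ∃ r > 0, ∀ᵐ ω ∂μ, ∀ᶠ N : ℕ in atTop,
      ∀ w ∈ Metric.closedBall a r, hEmpDeriv G N (fun t => X t ω) w ∈ W) :
    ∃ ρ > 0, ∀ᵐ ω ∂μ, ∀ᶠ N : ℕ in atTop, ∀ w ∈ Metric.closedBall a ρ,
      hEmp G N (fun t => X t ω) w ≠ 0 ∧ DifferentiableAt ℝ (fEmp G N fun t => X t ω) w ∧
      ‖fderiv ℝ (fEmp G N fun t => X t ω) w‖ ≤ 1 / 2 := by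
  have hν : ContinuousAt (fderiv ℝ fun y : Vec d => ‖y‖⁻¹ • y) h₀ :=
    (contDiffAt_norm_inv_smul hh₀).continuousAt_fderiv (by norm_num)
  have hcomp : ContinuousAt (fun p : Vec d × (Vec d →L[ℝ] Vec d) =>
      (fderiv ℝ (fun y : Vec d => ‖y‖⁻¹ • y) p.1).comp p.2) (h₀, T) :=
    (hν.comp (f := Prod.fst) (x := (h₀, T)) continuousAt_fst).clm_comp continuousAt_snd
  have hzero : (fderiv ℝ (fun y : Vec d => ‖y‖⁻¹ • y) h₀).comp T = 0 := by
    ext1 u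
    obtain ⟨c, hc⟩ := hT u
    rw [ContinuousLinearMap.comp_apply, hc, fderiv_norm_inv_smul_apply_smul hh₀]
    rfl
  have hev : ∀ᶠ p in 𝓝 (h₀, T), p.1 ≠ 0 ∧
      ‖(fderiv ℝ (fun y : Vec d => ‖y‖⁻¹ • y) p.1).comp p.2‖ < 1 / 2 := by
    refine (continuousAt_fst.eventually_ne hh₀).and (hcomp.norm.eventually_lt continuousAt_const ?_)
    simp only [hzero, norm_zero]
    norm_num
  rw [nhds_prod_eq] at hev
  obtain ⟨W₁, hW₁, W₂, hW₂, hsub⟩ := mem_prod_iff.1 hev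
  obtain ⟨r₁, hr₁, h₁⟩ := h W₁ hW₁
  obtain ⟨r₂, hr₂, h₂⟩ := h' W₂ hW₂
  refine ⟨min r₁ r₂, lt_min hr₁ hr₂, ?_⟩
  filter_upwards [h₁, h₂] with ω h₁ h₂
  filter_upwards [h₁, h₂] with N h₁ h₂ w hw
  obtain ⟨h0, hlt⟩ := hsub (Set.mk_mem_prod
    (h₁ w (Metric.closedBall_subset_closedBall (min_le_left _ _) hw))
    (h₂ w (Metric.closedBall_subset_closedBall (min_le_right _ _) hw)))
  have hd := hasFDerivAt_fEmp hG h0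
  exact ⟨h0, hd.differentiableAt, hd.fderiv ▸ hlt.le⟩

/-- The radius depends on `W`, but `a` lies in every ball; a countable basis at `h₀` yields one null
set. -/
theorem ae_tendsto_hEmp
    (h : ∀ W ∈ 𝓝 h₀, ∃ r > 0, ∀ᵐ ω ∂μ, ∀ᶠ N : ℕ in atTop,
      ∀ w ∈ Metric.closedBall a r, hEmp G N (fun t => X t ω) w ∈ W) :
    ∀ᵐ ω ∂μ, Tendsto (fun N => hEmp G N (fun t => X t ω) a) atTop (𝓝 h₀) := by
  have hk : ∀ᵐ ω ∂μ, ∀ k : ℕ, ∀ᶠ N in atTop,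
      hEmp G N (fun t => X t ω) a ∈ Metric.ball h₀ (1 / ((k : ℝ) + 1)) := by
    refine ae_all_iff.2 fun k => ?_
    obtain ⟨r, hr, hae⟩ := h _ (Metric.ball_mem_nhds h₀ (Nat.one_div_pos_of_nat (n := k)))
    filter_upwards [hae] with ω hω
    filter_upwards [hω] with N hN using hN a (Metric.mem_closedBall_self hr.le)
  filter_upwards [hk] with ω hω
  exact (Metric.nhds_basis_ball_inv_nat_succ.tendsto_right_iff).2 fun k _ => hω k

/-- If the empirical field and its derivative converge near a unit vector `a`, to a multiple of `a`
and to a map into the line of `a`, then `a` is close to an attractive fixed point. -/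
theorem exists_attractive_fixedPoint (hG : ContDiff ℝ 3 G) (hG_even : ∀ y, G (-y) = G y)
    (ha : ‖a‖ = 1) (hh₀ : h₀ ≠ 0) {c : ℝ} (hc : h₀ = c • a) (hT : ∀ u, ∃ c : ℝ, T u = c • h₀)
    (h : ∀ W ∈ 𝓝 h₀, ∃ r > 0, ∀ᵐ ω ∂μ, ∀ᶠ N : ℕ in atTop,
      ∀ w ∈ Metric.closedBall a r, hEmp G N (fun t => X t ω) w ∈ W)
    (h' : ∀ W ∈ 𝓝 T, ∃ r > 0, ∀ᵐ ω ∂μ, ∀ᶠ N : ℕ in atTop,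
      ∀ w ∈ Metric.closedBall a r, hEmpDeriv G N (fun t => X t ω) w ∈ W) :
    ∃ r > 0, ∃ aHat : ℕ → Ω → Vec d, ∀ᵐ ω ∂μ, Tendsto (fun N => aHat N ω) atTop (𝓝 a) ∧
      ∀ᶠ N in atTop, (∀ w, ‖w - a‖ < r →
        WideTendsto (fun n => (fEmp G N fun t => X t ω)^[n] w) (aHat N ω)) ∧
        aHat N ω ∈ setL G N fun t => X t ω := by
  obtain ⟨ρ, hρ, hder⟩ := exists_closedBall_ae_eventually_norm_fderiv_fEmp_le hG hh₀ hT h h'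
  -- `σ` is the sign for which `a` is fixed by `σ` times the limiting normalized field.
  obtain ⟨σ, hσ, hσa⟩ : ∃ σ : ℝ, (σ = 1 ∨ σ = -1) ∧ σ • ‖h₀‖⁻¹ • h₀ = a := by
    rcases norm_inv_smul_eq_of_eq_smul hh₀ ha hc with h | h
    · exact ⟨1, Or.inl rfl, by rw [h, one_smul]⟩
    · exact ⟨-1, Or.inr rfl, by rw [h, neg_one_smul, neg_neg]⟩
  have hσ1 : ‖σ‖ = 1 := by rcases hσ with rfl | rfl <;> simp
  let φ : ℕ → Ω → Vec d → Vec d := fun N ω w => σ • fEmp G N (fun t => X t ω) w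
  -- The choice is arbitrary when no such point exists, which is excluded for large `N`.
  refine ⟨ρ, hρ, fun N ω => Classical.epsilon fun v => v ∈ Metric.closedBall a ρ ∧ φ N ω v = v, ?_⟩
  filter_upwards [hder, ae_tendsto_hEmp h] with ω hω hlim
  have hφlim : Tendsto (fun N => φ N ω a) atTop (𝓝 a) := by
    have := (hlim.norm.inv₀ (norm_ne_zero_iff.2 hh₀)).smul hlim |>.const_smul σ
    rwa [hσa] at this
  have hφlim' : Tendsto (fun N => ‖φ N ω a - a‖) atTop (𝓝 0) :=
    tendsto_iff_norm_sub_tendsto_zero.1 hφlim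
  have hlip : ∀ᶠ N in atTop, ∀ y ∈ Metric.closedBall a ρ, ∀ z ∈ Metric.closedBall a ρ,
      ‖φ N ω y - φ N ω z‖ ≤ 1 / 2 * ‖y - z‖ := by
    filter_upwards [hω] with N hN y hy z hz
    rw [← smul_sub, norm_smul, hσ1, one_mul]
    exact (convex_closedBall a ρ).norm_image_sub_le_of_norm_fderiv_le
      (fun w hw => (hN w hw).2.1) (fun w hw => (hN w hw).2.2) hz hy
  have hfix : ∀ᶠ N in atTop,
      (Classical.epsilon fun v => v ∈ Metric.closedBall a ρ ∧ φ N ω v = v) ∈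
        Metric.closedBall a ρ ∧
      φ N ω (Classical.epsilon fun v => v ∈ Metric.closedBall a ρ ∧ φ N ω v = v) =
        Classical.epsilon fun v => v ∈ Metric.closedBall a ρ ∧ φ N ω v = v := by
    filter_upwards [hlip, hφlim'.eventually (ge_mem_nhds (half_pos hρ))] with N h1 h2
    exact Classical.epsilon_spec (exists_fixedPoint_of_half_lipschitz h1 hρ.le h2)
  -- Contraction gives `‖v - a‖ ≤ ‖v - a‖ / 2 + ‖φ a - a‖`, hence the factor 2.
  refine ⟨tendsto_iff_norm_sub_tendsto_zero.2 (squeeze_zero' (Eventually.of_forall fun _ =>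
    norm_nonneg _) ?_ (by simpa using hφlim'.const_mul 2)), ?_⟩
  · filter_upwards [hlip, hfix] with N h1 ⟨h2, h3⟩
    set v := Classical.epsilon fun v => v ∈ Metric.closedBall a ρ ∧ φ N ω v = v
    have h4 := h1 v h2 a (Metric.mem_closedBall_self hρ.le)
    rw [h3] at h4
    linarith [norm_sub_le_norm_sub_add_norm_sub v (φ N ω a) a]
  · filter_upwards [hlip, hfix, hω, hφlim'.eventually (ge_mem_nhds (half_pos hρ))] with
      N h1 ⟨h2, h3⟩ h4 h5
    set v := Classical.epsilon fun v => v ∈ Metric.closedBall a ρ ∧ φ N ω v = v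
    refine ⟨fun w hw => ?_, ⟨(h4 v h2).1, ?_⟩, (h4 v h2).2.1, (h4 v h2).2.2.trans_lt (by norm_num)⟩
    · refine tendsto_min_norm_iterate (φ := φ N ω) (fEmp_neg N _ hG_even) ?_ h1
        (mapsTo_closedBall_of_half_lipschitz h1 hρ.le h5) h2 h3 (mem_closedBall_iff_norm.2 hw.le)
      rcases hσ with rfl | rfl
      · left; intro x; exact one_smul _ _
      · right; intro x; exact neg_one_smul _ _
    · have h6 : σ • fEmp G N (fun t => X t ω) v = v := h3
      rcases hσ with rfl | rfl
      · left; rwa [one_smul] at h6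
      · right; rw [neg_one_smul] at h6; rw [← h6, neg_neg, h6]

end Attraction

end FastICA

/-! ### The main theorem. -/

open FastICA in
theorem theorem3 {Ω : Type*} [MeasurableSpace Ω] (μ : Measure Ω) [IsProbabilityMeasure μ]
    (d : ℕ) (A : Matrix (Fin d) (Fin d) ℝ) (hA : IsUnit A.det)
    (s : Ω → Vec d) (hs : IsSource s μ)
    (S : ℕ → Ω → Vec d) (hS_indep : iIndepFun S μ) (hS_ident : ∀ t, IdentDistrib (S t) s μ μ)
    (G : ℝ → ℝ) (hG : ContDiff ℝ 3 G) (hG_even : ∀ y, G (-y) = G y)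
    (hG_dom : Dominated G (whiten (observe A s) μ) μ)
    (hh : ∀ w ∈ unitSphere d, hPop G (whiten (observe A s) μ) μ w ≠ 0) :
    ∃ r : ℝ, 0 < r ∧ ∃ aHat : ℕ → Ω → Fin d → Vec d, ∀ᵐ ω ∂μ,
      (∀ i, Tendsto (fun N => aHat N ω i) atTop (𝓝 (demix A i))) ∧
      ∀ᶠ N in atTop,
        (∀ i, ∀ w₀ ∈ unitSphere d, ‖w₀ - demix A i‖ < r →
          WideTendsto (fun n => (fEmp G N (fun t => observe A (S t) ω))^[n] w₀) (aHat N ω i)) ∧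
        setD (aHat N ω) ⊆ setL G N (fun t => observe A (S t) ω) ∧
        setL G N (fun t => observe A (S t) ω) ⊆ setO G N (fun t => observe A (S t) ω) ∧
        setO G N (fun t => observe A (S t) ω) ⊆ setF G N (fun t => observe A (S t) ω) := by
  have hAm : Measurable fun v : Vec d => act A v :=
    (Matrix.toEuclideanCLM (n := Fin d) (𝕜 := ℝ) A).continuous.measurable
  have hindep : Pairwise fun i j => IndepFun (observe A (S i)) (observe A (S j)) μ :=
    fun i j hij => (hS_indep.indepFun hij).comp hAm hAm
  have hident : ∀ t, IdentDistrib (observe A (S t)) (observe A s) μ μ :=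
    fun t => (hS_ident t).comp hAm
  have hpos : (covMat (observe A s) μ).PosDef := covMat_observe hs A ▸ posDef_mul_transpose hA
  have hx := memLp_observe hs A
  set z := whiten (observe A s) μ with hz
  have hzm : AEMeasurable z μ := by
    refine (Matrix.toEuclideanCLM (n := Fin d) (𝕜 := ℝ)
      (invSqrt (covMat (observe A s) μ))).continuous.measurable.comp_aemeasurable
      ((hident 0).aemeasurable_snd.sub_const _)
  have hcoord : ∀ j ω, inner ℝ (demixBasis hA j) (z ω) = s ω j - ∫ ω, s ω j ∂μ := fun j ω => by
    rw [demixBasis_apply, hz, inner_demix_whiten hs hA]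
  have hind : iIndepFun (fun j ω => inner ℝ (demixBasis hA j) (z ω)) μ := by
    simp only [hcoord]
    exact hs.indep.comp (fun j y => y - ∫ ω, s ω j ∂μ) fun j => by fun_prop
  have hL2 : ∀ j, MemLp (fun ω => inner ℝ (demixBasis hA j) (z ω)) 2 μ := fun j => by
    simp only [hcoord]
    exact (hs.memLp j).sub (memLp_const _)
  have hmean : ∀ j, ∫ ω, inner ℝ (demixBasis hA j) (z ω) ∂μ = 0 := fun j => by
    simp only [hcoord]
    rw [integral_sub ((hs.memLp j).integrable one_le_two) (integrable_const _)]
    simp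
  have hvar : ∀ j, ∫ ω, inner ℝ (demixBasis hA j) (z ω) ^ 2 ∂μ = 1 := fun j => by
    simp only [hcoord]
    rw [← variance_eq_integral (hs.memLp j).aestronglyMeasurable.aemeasurable]
    exact hs.unit_variance j
  have hnorm : ∀ i, ‖demix A i‖ = 1 := (orthonormal_demix hA).1
  have hloc : ∀ i, ∃ r > 0, ∃ aHat : ℕ → Ω → Vec d, ∀ᵐ ω ∂μ,
      Tendsto (fun N => aHat N ω) atTop (𝓝 (demix A i)) ∧
      ∀ᶠ N in atTop, (∀ w, ‖w - demix A i‖ < r →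
        WideTendsto (fun n => (fEmp G N fun t => observe A (S t) ω)^[n] w) (aHat N ω)) ∧
        aHat N ω ∈ setL G N fun t => observe A (S t) ω := by
    intro i
    obtain ⟨hi, hi', hW, hW'⟩ := exists_closedBall_ae_eventually_hEmp_mem hG hindep hident hx hpos
      hG_dom (hnorm i)
    rw [← demixBasis_apply hA] at hi hi'
    obtain ⟨c, hc⟩ := integral_icaTerm_eq_smul hG hzm hind hmean i hi
    have hT := integral_icaTermDeriv_apply_eq_smul hG hzm hind hL2 hmean hvar i hi'
    rw [demixBasis_apply] at hc hT
    have hne := hh (demix A i) (mem_sphere_zero_iff_norm.2 (hnorm i))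
    have hc' : hPop G z μ (demix A i) = c • demix A i := hc
    have hc0 : c ≠ 0 := by rintro rfl; exact hne (by rw [hc', zero_smul])
    refine exists_attractive_fixedPoint hG hG_even (hnorm i) hne hc' (fun u => ?_) hW hW'
    obtain ⟨e, he⟩ := hT u
    -- Multiples of `a_i` are multiples of `h(a_i) = c a_i` because `h` does not vanish on the
    -- sphere.
    exact ⟨e / c, by rw [he, hc', smul_smul, div_mul_cancel₀ _ hc0]⟩
  choose r hr aHat hae using hloc
  obtain ⟨r₀, hr₀, hr₀r⟩ : ∃ r₀ > 0, ∀ i, r₀ ≤ r i := by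
    rcases isEmpty_or_nonempty (Fin d) with h | h
    · exact ⟨1, one_pos, fun i => h.elim i⟩
    · obtain ⟨i, hi⟩ := Finite.exists_min r
      exact ⟨r i, hr i, hi⟩
  refine ⟨r₀, hr₀, fun N ω i => aHat i N ω, ?_⟩
  filter_upwards [ae_all_iff.2 hae, ae_eventually_hEmp_ne_zero hG hindep hident hx hpos hG_dom hh]
    with ω h1 h2
  refine ⟨fun i => (h1 i).1, ?_⟩
  filter_upwards [eventually_all.2 fun i => (h1 i).2, h2] with N h3 h4
  refine ⟨fun i w₀ _ hw => (h3 i).1 w₀ (hw.trans_le (hr₀r i)), ?_, setL_subset_setO N _ hG,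
    setO_subset_setF N _ hG h4⟩
  rintro v ⟨i, rfl | rfl⟩
  · exact (h3 i).2
  · exact neg_mem_setL hG_even (h3 i).2
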